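/- Let $T>0$, let $N:[0,T]\to\mathbb R^{n\times n}$ be continuous, $B\in\mathbb R^{n\times m}$, and let $Q,Q_0\in\mathbb R^{n\times n}$ be symmetric and positive semidefinite. For $\tau\in[0,T]$, a state $(\hat x,\tilde x)\in\mathbb R^n\times L^2(0,\tau;\mathbb R^n)$ and a control $u\in L^2(\tau,T;\mathbb R^m)$, let $x$ be the (absolutely continuous) solution on $[\tau,T]$ of $$x'(t)=\int_\tau^t N(t-s)x(s)\,ds+Bu(t)+\int_0^\tau N(t-s)\tilde x(s)\,ds,\qquad x(\tau)=\hat x,$$ and put $$J_\tau(\hat x,\tilde x;u)=\int_\tau^T\big[x^*(t)Qx(t)+|u(t)|^2\big]dt+x^*(T)Q_0x(T),\qquad W(\tau;\hat x,\tilde x)=\inf_{u\in L^2(\tau,T;\mathbb R^m)}J_\tau(\hat x,\tilde x;u).$$ Call $(P_0,P_1,K)$ kernels of the value function if $P_0(t)$ ($0\le t\le T$), $P_1(t,s)$ ($0\le s\le t\le T$) and $K(t,\xi,r)$ ($0\le \xi,r\le t\le T$) are continuous $n\times n$ matrix functions with $P_0(t)=P_0(t)^*$ and $K(t,\xi,r)=K(t,r,\xi)^*$,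 such that for all $\tau\in[0,T]$ and all $(\hat x,\tilde x)\in\mathbb R^n\times L^2(0,\tau;\mathbb R^n)$ $$W(\tau;\hat x,\tilde x)=\hat x^*P_0(\tau)\hat x+\hat x^*\!\int_0^\tau\! P_1(\tau,s)\tilde x(s)\,ds+\Big[\int_0^\tau\! P_1(\tau,s)\tilde x(s)\,ds\Big]^*\hat x+\int_0^\tau\!\!\int_0^\tau \tilde x^*(r)K(\tau,\xi,r)\tilde x(\xi)\,d\xi\,dr .$$ Then kernels of the value function exist. Moreover, for any such kernels, every $\tau\in[0,T)$ and every $(\hat x,\tilde x)\in\mathbb R^n\times L^2(0,\tau;\mathbb R^n)$, the cost $J_\tau(\hat x,\tilde x;\cdot)$ has a unique minimizer $u^+\in L^2(\tau,T;\mathbb R^m)$ (up to equality almost everywhere). It has a representative that is continuous on $[\tau,T]$, and this representative satisfies $$u^+(\tau)=-B^*\Big[P_0(\tau)\hat x+\int_0^\tau P_1(\tau,s)\tilde x(s)\,ds\Big].$$ Furthermore, if $x^+$ denotes the corresponding solution on $[\tau,T]$, extended by $x^+=\tilde x$ on $(0,\tau)$, then for every $t\in[\tau,T]$ $$u^+(t)=-B^*\Big[P_0(t)x^+(t)+\int_0^t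 P_1(t,s)x^+(s)\,ds\Big].$$ -/

import Mathlib

open MeasureTheory Set Matrix

namespace VolterraLQ

variable {n m : ℕ}

/-- `x` solves, on `[τ, T]` and in the integrated (Carathéodory) sense,
`x' (t) = ∫_τ^t N(t-s) x(s) ds + B u(t) + ∫_0^τ N(t-s) xt(s) ds`, `x(τ) = xh`.
The pair `(xh, xt)` is the state at time `τ`. -/
def IsTrajectory (T : ℝ) (N : ℝ → Matrix (Fin n) (Fin n) ℝ) (B : Matrix (Fin n) (Fin m) ℝ)
    (τ : ℝ) (xh : Fin n → ℝ) (xt : ℝ → Fin n → ℝ) (u : ℝ → Fin m → ℝ) (x : ℝ → Fin n → ℝ) :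
    Prop :=
  ContinuousOn x (Icc τ T) ∧
    ∀ t ∈ Icc τ T, x t = xh + ∫ σ in τ..t,
      ((∫ s in τ..σ, N (σ - s) *ᵥ x s) + B *ᵥ u σ + ∫ s in (0 : ℝ)..τ, N (σ - s) *ᵥ xt s)

/-- `f` belongs to `L²(a, b; ℝᵏ)`. -/
def IsL2 {k : ℕ} (a b : ℝ) (f : ℝ → Fin k → ℝ) : Prop :=
  MemLp f 2 (volume.restrict (Ioc a b))

/-- `u` is a control in `L²(τ, T; ℝᵐ)` and `x` is the corresponding trajectory. -/
def IsAdmissiblePair (T : ℝ) (N : ℝ → Matrix (Fin n) (Fin n) ℝ) (B : Matrix (Fin n) (Fin m) ℝ)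
    (τ : ℝ) (xh : Fin n → ℝ) (xt : ℝ → Fin n → ℝ) (u : ℝ → Fin m → ℝ) (x : ℝ → Fin n → ℝ) :
    Prop :=
  IsL2 τ T u ∧ IsTrajectory T N B τ xh xt u x

/-- The quadratic cost on `[τ, T]`. -/
noncomputable def cost (T : ℝ) (Q Q₀ : Matrix (Fin n) (Fin n) ℝ) (τ : ℝ)
    (u : ℝ → Fin m → ℝ) (x : ℝ → Fin n → ℝ) : ℝ :=
  (∫ t in τ..T, (x t ⬝ᵥ Q *ᵥ x t + u t ⬝ᵥ u t)) + x T ⬝ᵥ Q₀ *ᵥ x T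

/-- `u` minimizes the cost from the state `(xh, xt)` at time `τ`, with trajectory `x`. -/
def IsOptimalPair (T : ℝ) (N : ℝ → Matrix (Fin n) (Fin n) ℝ) (B : Matrix (Fin n) (Fin m) ℝ)
    (Q Q₀ : Matrix (Fin n) (Fin n) ℝ) (τ : ℝ) (xh : Fin n → ℝ) (xt : ℝ → Fin n → ℝ)
    (u : ℝ → Fin m → ℝ) (x : ℝ → Fin n → ℝ) : Prop :=
  IsAdmissiblePair T N B τ xh xt u x ∧
    ∀ v y, IsAdmissiblePair T N B τ xh xt v y → cost T Q Q₀ τ u x ≤ cost T Q Q₀ τ v y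

/-- The value function `W(τ; (xh, xt))`. -/
noncomputable def valueFunction (T : ℝ) (N : ℝ → Matrix (Fin n) (Fin n) ℝ)
    (B : Matrix (Fin n) (Fin m) ℝ) (Q Q₀ : Matrix (Fin n) (Fin n) ℝ) (τ : ℝ)
    (xh : Fin n → ℝ) (xt : ℝ → Fin n → ℝ) : ℝ :=
  sInf {c : ℝ | ∃ u x, IsAdmissiblePair T N B τ xh xt u x ∧ c = cost T Q Q₀ τ u x}

/-- `P₀`, `P₁`, `K` are the (continuous, symmetric) kernels of the quadratic form
`(xh, xt) ↦ W(τ; (xh, xt))` on `ℝⁿ × L²(0, τ; ℝⁿ)`, for every `τ ∈ [0, T]`. -/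
structure IsValueKernel (T : ℝ) (N : ℝ → Matrix (Fin n) (Fin n) ℝ)
    (B : Matrix (Fin n) (Fin m) ℝ) (Q Q₀ : Matrix (Fin n) (Fin n) ℝ)
    (P₀ : ℝ → Matrix (Fin n) (Fin n) ℝ) (P₁ : ℝ → ℝ → Matrix (Fin n) (Fin n) ℝ)
    (K : ℝ → ℝ → ℝ → Matrix (Fin n) (Fin n) ℝ) : Prop where
  continuousOn_P₀ : ContinuousOn P₀ (Icc 0 T)
  continuousOn_P₁ : ContinuousOn (fun p : ℝ × ℝ => P₁ p.1 p.2)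
    {p | 0 ≤ p.2 ∧ p.2 ≤ p.1 ∧ p.1 ≤ T}
  continuousOn_K : ContinuousOn (fun p : ℝ × ℝ × ℝ => K p.1 p.2.1 p.2.2)
    {p | p.1 ≤ T ∧ p.2.1 ∈ Icc 0 p.1 ∧ p.2.2 ∈ Icc 0 p.1}
  symm_P₀ : ∀ t ∈ Icc 0 T, (P₀ t)ᵀ = P₀ t
  symm_K : ∀ t ∈ Icc 0 T, ∀ ξ ∈ Icc 0 t, ∀ r ∈ Icc 0 t, K t ξ r = (K t r ξ)ᵀ
  value_eq : ∀ τ ∈ Icc 0 T, ∀ (xh : Fin n → ℝ) (xt : ℝ → Fin n → ℝ), IsL2 0 τ xt →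
    valueFunction T N B Q Q₀ τ xh xt =
      xh ⬝ᵥ P₀ τ *ᵥ xh
        + xh ⬝ᵥ (∫ s in (0 : ℝ)..τ, P₁ τ s *ᵥ xt s)
        + (∫ s in (0 : ℝ)..τ, P₁ τ s *ᵥ xt s) ⬝ᵥ xh
        + ∫ r in (0 : ℝ)..τ, ∫ ξ in (0 : ℝ)..τ, xt r ⬝ᵥ K τ ξ r *ᵥ xt ξ

/-- The prescribed history `xt` on `(0, τ)`, followed by the trajectory `x` from `τ` on. -/
noncomputable def extendBy (τ : ℝ) (xt x : ℝ → Fin n → ℝ) (s : ℝ) : Fin n → ℝ :=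
  if s < τ then xt s else x s

end VolterraLQ

/-! Pontryagin's optimality system replaces the minimization. An extremal is a pair `(x, p)` in
which `x` solves the state equation with control `-Bᵀ *ᵥ p` and `p` solves the adjoint Volterra
equation backward from `Q₀ *ᵥ x T`. Duality of the two equations (`state_costate_duality`) kills the
cross term when the cost is expanded around an extremal (`IsExtremal.cost_eq`). The remainder is a
nonnegative quadratic in the deviation that contains the integral of `|v - u|²`, so an extremal
gives the unique minimizer, and its control is continuous because `p` is.

Extremals exist by the Fredholm alternative. On pairs of continuous paths the system reads `z = (f,
0) + S z`, where `S` depends on `τ` and is compact, while `f` depends linearly on the state. A fixed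
point of `S` is an extremal of the zero state, hence zero by uniqueness, so `1 - S` is invertible.
As `S` is norm continuous in `τ`, so is the solution operator. The value is therefore a symmetric
bilinear form evaluated at `(f, f)`, jointly continuous in `τ` and its arguments. Since `f` is a
constant path plus an integral over the history, moving the form under the integrals produces the
kernels.

For arbitrary kernels, polarizing the value in `xh` identifies `p τ` with `P₀ τ *ᵥ xh + ∫ P₁ τ s *ᵥ
xt s` (`IsExtremal.costate_eq_kernel`). An extremal restricted to `[t, T]` is an extremal for the
state reached at `t` (`IsExtremal.restrict`), so the same formula holds at every later time. -/

namespace VolterraLQ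

variable {n m : ℕ}

/-! ### Dot products, matrices and convolutions under the integral -/

/-- The functional `w ↦ v ⬝ᵥ w`. -/
noncomputable def dotCLM (v : Fin n → ℝ) : (Fin n → ℝ) →L[ℝ] ℝ :=
  ∑ i, v i • ContinuousLinearMap.proj i

@[simp]
theorem dotCLM_apply (v w : Fin n → ℝ) : dotCLM v w = v ⬝ᵥ w := by
  simp [dotCLM, dotProduct]

/-- The continuous linear map `v ↦ A *ᵥ v`. -/
noncomputable def mulVecCLM (A : Matrix (Fin n) (Fin m) ℝ) : (Fin m → ℝ) →L[ℝ] (Fin n → ℝ) :=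
  LinearMap.toContinuousLinearMap A.mulVecLin

@[simp]
theorem mulVecCLM_apply (A : Matrix (Fin n) (Fin m) ℝ) (v : Fin m → ℝ) :
    mulVecCLM A v = A *ᵥ v := rfl

theorem continuous_mulVecCLM : Continuous (mulVecCLM : Matrix (Fin n) (Fin m) ℝ → _) := by
  rw [continuous_clm_apply]
  intro v
  simp only [mulVecCLM_apply]
  fun_prop

theorem dotProduct_intervalIntegral {a b : ℝ} (v : Fin n → ℝ) {f : ℝ → Fin n → ℝ}
    (hf : IntervalIntegrable f volume a b) :
    v ⬝ᵥ (∫ s in a..b, f s) = ∫ s in a..b, v ⬝ᵥ f s := by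
  simpa using ((dotCLM v).intervalIntegral_comp_comm hf).symm

theorem intervalIntegral_dotProduct {a b : ℝ} (v : Fin n → ℝ) {f : ℝ → Fin n → ℝ}
    (hf : IntervalIntegrable f volume a b) :
    (∫ s in a..b, f s) ⬝ᵥ v = ∫ s in a..b, f s ⬝ᵥ v := by
  simp_rw [dotProduct_comm _ v]
  exact dotProduct_intervalIntegral v hf

theorem intervalIntegrable_pi {a b : ℝ} {f : ℝ → Fin n → ℝ}
    (hf : IntervalIntegrable f volume a b) (i : Fin n) :
    IntervalIntegrable (fun s => f s i) volume a b :=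
  ⟨hf.1.eval i, hf.2.eval i⟩

theorem intervalIntegrable_dotProduct {a b : ℝ} {f g : ℝ → Fin n → ℝ} (hf : Continuous f)
    (hg : IntervalIntegrable g volume a b) :
    IntervalIntegrable (fun s => f s ⬝ᵥ g s) volume a b := by
  have h := IntervalIntegrable.sum (μ := volume) (a := a) (b := b) Finset.univ
    (f := fun i s => f s i * g s i)
    fun i _ => (intervalIntegrable_pi hg i).continuousOn_mul (by fun_prop)
  have e : (fun s => f s ⬝ᵥ g s) = ∑ i, fun s => f s i * g s i := by
    ext s
    simp [dotProduct]
  rw [e]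
  exact h

theorem intervalIntegrable_mulVec {a b : ℝ} (A : Matrix (Fin n) (Fin m) ℝ) {f : ℝ → Fin m → ℝ}
    (hf : IntervalIntegrable f volume a b) :
    IntervalIntegrable (fun s => A *ᵥ f s) volume a b :=
  ⟨(mulVecCLM A).integrable_comp hf.1, (mulVecCLM A).integrable_comp hf.2⟩

theorem continuous_forward_convolution {N : ℝ → Matrix (Fin n) (Fin n) ℝ} (hN : Continuous N)
    {y : ℝ → Fin n → ℝ} (hy : Continuous y) (a : ℝ) :
    Continuous fun σ => ∫ s in a..σ, N (σ - s) *ᵥ y s := by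
  have : Continuous (Function.uncurry fun σ s : ℝ => N (σ - s) *ᵥ y s) := by
    simp only [Function.uncurry_def]
    fun_prop
  fun_prop

theorem continuous_backward_convolution {N : ℝ → Matrix (Fin n) (Fin n) ℝ} (hN : Continuous N)
    {p : ℝ → Fin n → ℝ} (hp : Continuous p) (b : ℝ) :
    Continuous fun σ => ∫ r in σ..b, (N (r - σ))ᵀ *ᵥ p r := by
  have : Continuous (Function.uncurry fun σ r : ℝ => (N (r - σ))ᵀ *ᵥ p r) := by
    simp only [Function.uncurry_def]
    fun_prop
  simp_rw [intervalIntegral.integral_symm b]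
  fun_prop

/-! ### Fubini on a triangle and state–costate duality -/

/-- Fubini's theorem on the triangle `a < s ≤ t ≤ b`. -/
theorem integral_triangle_swap {f : ℝ → ℝ → ℝ} {a b : ℝ} (hab : a ≤ b)
    (hf : Integrable (Function.uncurry f)
      ((volume.restrict (Ioc a b)).prod (volume.restrict (Ioc a b)))) :
    ∫ t in a..b, ∫ s in a..t, f t s = ∫ s in a..b, ∫ t in s..b, f t s := by
  have hD : MeasurableSet {q : ℝ × ℝ | q.2 ≤ q.1} := measurableSet_le measurable_snd measurable_fst
  -- The indicator of the triangle turns the variable limits into a fixed square.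
  have h := integral_integral_swap (f := fun t s => {q : ℝ × ℝ | q.2 ≤ q.1}.indicator
    (Function.uncurry f) (t, s)) (hf.indicator hD)
  rw [intervalIntegral.integral_of_le hab, intervalIntegral.integral_of_le hab]
  convert h using 1
  · refine setIntegral_congr_fun measurableSet_Ioc fun t ht => ?_
    have : ∀ s, {q : ℝ × ℝ | q.2 ≤ q.1}.indicator (Function.uncurry f) (t, s)
        = (Iic t).indicator (f t) s := fun s => by simp [indicator, Function.uncurry]
    simp_rw [this]
    rw [setIntegral_indicator measurableSet_Iic, intervalIntegral.integral_of_le ht.1.le]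
    congr 2
    ext s; simp only [mem_Ioc, mem_inter_iff, mem_Iic]
    exact ⟨fun h => ⟨⟨h.1, h.2.trans ht.2⟩, h.2⟩, fun h => ⟨h.1.1, h.2⟩⟩
  · refine setIntegral_congr_fun measurableSet_Ioc fun s hs => ?_
    have : ∀ t, {q : ℝ × ℝ | q.2 ≤ q.1}.indicator (Function.uncurry f) (t, s)
        = (Ici s).indicator (fun t => f t s) t := fun t => by simp [indicator, Function.uncurry]
    simp_rw [this]
    rw [setIntegral_indicator measurableSet_Ici, intervalIntegral.integral_of_le hs.2,
      ← integral_Icc_eq_integral_Ioc]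
    congr 2
    ext t; simp only [mem_Ioc, mem_inter_iff, mem_Icc, mem_Ici]
    exact ⟨fun h => ⟨⟨hs.1.trans_le h.1, h.2⟩, h.1⟩, fun h => ⟨h.2, h.1.2⟩⟩

/-- Integration by parts for primitives, in a form that needs only integrability: the forcing may be
an `L²` control, so nothing is differentiated. -/
theorem integral_triangle_swap_dotProduct {f g : ℝ → Fin n → ℝ} {a b : ℝ} (hab : a ≤ b)
    (hf : IntervalIntegrable f volume a b) (hg : IntervalIntegrable g volume a b) :
    ∫ t in a..b, f t ⬝ᵥ ∫ s in a..t, g s = ∫ s in a..b, (∫ t in s..b, f t) ⬝ᵥ g s := by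
  have key : Integrable (Function.uncurry fun t s => f t ⬝ᵥ g s)
      ((volume.restrict (Ioc a b)).prod (volume.restrict (Ioc a b))) := by
    simp only [dotProduct, Function.uncurry_def]
    exact integrable_finsetSum _ fun i _ => (hf.1.eval i).mul_prod (hg.1.eval i)
  have h := integral_triangle_swap hab key
  convert h using 1
  · refine intervalIntegral.integral_congr fun t ht => ?_
    rw [uIcc_of_le hab] at ht
    exact dotProduct_intervalIntegral _ (hg.mono_set (by
      rw [uIcc_of_le hab, uIcc_of_le ht.1]; exact Icc_subset_Icc_right ht.2))
  · refine intervalIntegral.integral_congr fun s hs => ?_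
    rw [uIcc_of_le hab] at hs
    exact intervalIntegral_dotProduct _ (hf.mono_set (by
      rw [uIcc_of_le hab, uIcc_of_le hs.2]; exact Icc_subset_Icc_left hs.1))

/-- The adjoint of the forward convolution is the backward one with transposed kernel; this is where
the memory term of the costate equation comes from. -/
theorem integral_convolution_adjoint {N : ℝ → Matrix (Fin n) (Fin n) ℝ} (hN : Continuous N)
    {p y : ℝ → Fin n → ℝ} (hp : Continuous p) (hy : Continuous y) {a b : ℝ} (hab : a ≤ b) :
    ∫ t in a..b, p t ⬝ᵥ ∫ s in a..t, N (t - s) *ᵥ y s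
      = ∫ s in a..b, (∫ t in s..b, (N (t - s))ᵀ *ᵥ p t) ⬝ᵥ y s := by
  have hc : Continuous (Function.uncurry fun t s => p t ⬝ᵥ N (t - s) *ᵥ y s) := by
    simp only [Function.uncurry_def]
    fun_prop
  have key : Integrable (Function.uncurry fun t s => p t ⬝ᵥ N (t - s) *ᵥ y s)
      ((volume.restrict (Ioc a b)).prod (volume.restrict (Ioc a b))) := by
    rw [Measure.prod_restrict]
    exact (hc.continuousOn.integrableOn_compact (isCompact_Icc.prod isCompact_Icc)).mono_set
      (prod_mono Ioc_subset_Icc_self Ioc_subset_Icc_self)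
  have h := integral_triangle_swap hab key
  convert h using 1
  · refine intervalIntegral.integral_congr fun t _ => ?_
    exact dotProduct_intervalIntegral _ (Continuous.intervalIntegrable (by fun_prop) _ _)
  · refine intervalIntegral.integral_congr fun s _ => ?_
    rw [intervalIntegral_dotProduct _ (Continuous.intervalIntegrable (by fun_prop) _ _)]
    refine intervalIntegral.integral_congr fun t _ => ?_
    rw [Matrix.mulVec_transpose, Matrix.dotProduct_mulVec]

/-- Duality between the linear Volterra equation and its adjoint equation. -/
theorem state_costate_duality {T τ : ℝ} (hτ : τ ≤ T) {N : ℝ → Matrix (Fin n) (Fin n) ℝ}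
    (hN : Continuous N) {H p y z : ℝ → Fin n → ℝ} {h c : Fin n → ℝ}
    (hH : Continuous H) (hp : Continuous p) (hy : Continuous y)
    (hz : IntervalIntegrable z volume τ T)
    (hy_eq : ∀ t ∈ Icc τ T, y t = h + ∫ σ in τ..t, ((∫ s in τ..σ, N (σ - s) *ᵥ y s) + z σ))
    (hp_eq : ∀ s ∈ Icc τ T, p s = c + ∫ σ in s..T, (H σ + ∫ r in σ..T, (N (r - σ))ᵀ *ᵥ p r)) :
    h ⬝ᵥ p τ + ∫ t in τ..T, p t ⬝ᵥ z t = y T ⬝ᵥ c + ∫ t in τ..T, y t ⬝ᵥ H t := by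
  set F : ℝ → Fin n → ℝ := fun σ => ∫ s in τ..σ, N (σ - s) *ᵥ y s with hF
  set G : ℝ → Fin n → ℝ := fun σ => ∫ r in σ..T, (N (r - σ))ᵀ *ᵥ p r with hG
  have hFc : Continuous F := continuous_forward_convolution hN hy τ
  have hGc : Continuous G := continuous_backward_convolution hN hp T
  have hw : IntervalIntegrable (fun σ => F σ + z σ) volume τ T :=
    (hFc.intervalIntegrable _ _).add hz
  have hHG : IntervalIntegrable (fun σ => H σ + G σ) volume τ T :=
    (hH.add hGc).intervalIntegrable _ _
  -- The inner integrals in `e1` are `y - h` and `p - c`. Substituting them (`e3`, `e4`) leaves two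
  -- convolution terms, which cancel by `e2`.
  have e1 := integral_triangle_swap_dotProduct hτ hHG hw
  have e2 : ∫ t in τ..T, p t ⬝ᵥ F t = ∫ s in τ..T, G s ⬝ᵥ y s :=
    integral_convolution_adjoint hN hp hy hτ
  have e3 : ∫ t in τ..T, (H t + G t) ⬝ᵥ ∫ s in τ..t, (F s + z s)
      = (∫ t in τ..T, H t ⬝ᵥ y t) + (∫ t in τ..T, G t ⬝ᵥ y t)
        - (∫ t in τ..T, (H t + G t)) ⬝ᵥ h := by
    rw [intervalIntegral_dotProduct _ hHG, ← intervalIntegral.integral_add,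
      ← intervalIntegral.integral_sub]
    · refine intervalIntegral.integral_congr fun t ht => ?_
      rw [uIcc_of_le hτ] at ht
      have : ∫ s in τ..t, (F s + z s) = y t - h := by rw [hy_eq t ht]; simp [hF]
      simp only [this, dotProduct_sub, add_dotProduct]
    all_goals exact Continuous.intervalIntegrable (by fun_prop) _ _
  have e4 : ∫ s in τ..T, (∫ t in s..T, (H t + G t)) ⬝ᵥ (F s + z s)
      = (∫ t in τ..T, p t ⬝ᵥ F t) + (∫ t in τ..T, p t ⬝ᵥ z t)
        - c ⬝ᵥ ∫ t in τ..T, (F t + z t) := by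
    rw [dotProduct_intervalIntegral _ hw, ← intervalIntegral.integral_add,
      ← intervalIntegral.integral_sub]
    · refine intervalIntegral.integral_congr fun t ht => ?_
      rw [uIcc_of_le hτ] at ht
      have : ∫ s in t..T, (H s + G s) = p t - c := by rw [hp_eq t ht]; simp [hG]
      simp only [this, sub_dotProduct, dotProduct_add]
      ring
    · exact (Continuous.intervalIntegrable (by fun_prop) _ _).add
        (intervalIntegrable_dotProduct hp hz)
    · exact intervalIntegrable_dotProduct continuous_const hw
    · exact Continuous.intervalIntegrable (by fun_prop) _ _
    · exact intervalIntegrable_dotProduct hp hz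
  have e5 : ∫ s in τ..T, (F s + z s) = y T - h := by rw [hy_eq T ⟨hτ, le_rfl⟩]; simp [hF]
  have e6 : p τ = c + ∫ t in τ..T, (H t + G t) := hp_eq τ ⟨le_rfl, hτ⟩
  rw [e5] at e4
  simp_rw [dotProduct_comm (y _)]
  rw [e6, dotProduct_add, dotProduct_comm h c, dotProduct_comm h]
  rw [dotProduct_sub] at e4
  linarith

/-! ### Uniqueness for homogeneous Volterra equations -/

/-- A continuous function dominated by a multiple of its own primitive vanishes. -/
theorem eq_zero_of_norm_le_integral {x : ℝ → Fin n → ℝ} (hx : Continuous x) {a b C : ℝ}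
    (h : ∀ t ∈ Icc a b, ‖x t‖ ≤ C * ∫ s in a..t, ‖x s‖) : ∀ t ∈ Icc a b, x t = 0 := by
  have hS : ∀ t ∈ Icc a b, ∫ s in a..t, ‖x s‖ = 0 := by
    -- Grönwall for the primitive of `‖x‖`: it starts at zero and its derivative is at most `C`
    -- times itself.
    refine eq_zero_of_abs_deriv_le_mul_abs_self_of_eq_zero_right (K := C) (f' := fun t => ‖x t‖)
      ?_ ?_ (by simp) ?_
    · exact (intervalIntegral.continuous_primitive
        (fun _ _ => hx.norm.intervalIntegrable _ _) a).continuousOn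
    · intro t _
      exact (intervalIntegral.integral_hasDerivAt_right (hx.norm.intervalIntegrable _ _)
        (hx.norm.stronglyMeasurableAtFilter _ _) hx.norm.continuousAt).hasDerivWithinAt
    · intro t ht
      have h0 : 0 ≤ ∫ s in a..t, ‖x s‖ :=
        intervalIntegral.integral_nonneg ht.1 fun _ _ => norm_nonneg _
      simpa [abs_of_nonneg h0] using h t ⟨ht.1, ht.2.le⟩
  intro t ht
  have := h t ht
  rw [hS t ht, mul_zero] at this
  exact norm_le_zero_iff.mp this

/-- With `C` a bound for the operator norm of `N` on `[0, b - a]`, the inner integral is at most `C`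
times the primitive of `‖x‖` at `t`; the outer integration costs a further factor `b - a`. -/
theorem forward_eq_zero {N : ℝ → Matrix (Fin n) (Fin n) ℝ} (hN : Continuous N)
    {x : ℝ → Fin n → ℝ} (hx : Continuous x) {a b : ℝ}
    (h : ∀ t ∈ Icc a b, x t = ∫ σ in a..t, ∫ s in a..σ, N (σ - s) *ᵥ x s) :
    ∀ t ∈ Icc a b, x t = 0 := by
  obtain ⟨C, hC⟩ := (isCompact_Icc (a := 0) (b := b - a)).exists_bound_of_continuousOn
    (continuous_mulVecCLM.comp hN).continuousOn
  refine eq_zero_of_norm_le_integral hx (C := C * (b - a)) fun t ht => ?_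
  have hC0 : 0 ≤ C := (norm_nonneg _).trans (hC 0 ⟨le_rfl, by linarith [ht.1, ht.2]⟩)
  have hmono : ∀ σ ∈ Icc a t, ∫ s in a..σ, ‖x s‖ ≤ ∫ s in a..t, ‖x s‖ := fun σ hσ =>
    intervalIntegral.integral_mono_interval le_rfl hσ.1 hσ.2
      (Filter.Eventually.of_forall fun _ => norm_nonneg _) (hx.norm.intervalIntegrable _ _)
  have h0 : 0 ≤ ∫ s in a..t, ‖x s‖ :=
    intervalIntegral.integral_nonneg ht.1 fun _ _ => norm_nonneg _
  have inner : ∀ σ ∈ uIoc a t, ‖∫ s in a..σ, N (σ - s) *ᵥ x s‖ ≤ C * ∫ s in a..t, ‖x s‖ := by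
    intro σ hσ
    rw [uIoc_of_le ht.1] at hσ
    refine le_trans ?_ (mul_le_mul_of_nonneg_left (hmono σ ⟨hσ.1.le, hσ.2⟩) hC0)
    rw [← intervalIntegral.integral_const_mul]
    refine intervalIntegral.norm_integral_le_of_norm_le hσ.1.le
      (Filter.Eventually.of_forall fun s hs => ?_)
      (Continuous.intervalIntegrable (by fun_prop) _ _)
    have := (mulVecCLM (N (σ - s))).le_opNorm (x s)
    refine this.trans (mul_le_mul_of_nonneg_right (hC (σ - s) ⟨?_, ?_⟩) (norm_nonneg _))
    · linarith [hs.2]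
    · linarith [hs.1, hσ.2, ht.2]
  calc ‖x t‖ = ‖∫ σ in a..t, ∫ s in a..σ, N (σ - s) *ᵥ x s‖ := by rw [← h t ht]
    _ ≤ (C * ∫ s in a..t, ‖x s‖) * |t - a| := intervalIntegral.norm_integral_le_of_norm_le_const inner
    _ ≤ (C * ∫ s in a..t, ‖x s‖) * (b - a) := by
      rw [abs_of_nonneg (by linarith [ht.1])]
      exact mul_le_mul_of_nonneg_left (by linarith [ht.2]) (mul_nonneg hC0 h0)
    _ = C * (b - a) * ∫ s in a..t, ‖x s‖ := by ring

/-- The reflection `t ↦ a + b - t` turns this into the forward equation with kernel `Nᵀ`. -/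
theorem backward_eq_zero {N : ℝ → Matrix (Fin n) (Fin n) ℝ} (hN : Continuous N)
    {p : ℝ → Fin n → ℝ} (hp : Continuous p) {a b : ℝ}
    (h : ∀ s ∈ Icc a b, p s = ∫ σ in s..b, ∫ r in σ..b, (N (r - σ))ᵀ *ᵥ p r) :
    ∀ s ∈ Icc a b, p s = 0 := by
  have key := forward_eq_zero (N := fun t => (N t)ᵀ) (by fun_prop)
    (x := fun t => p (a + b - t)) (by fun_prop) (a := a) (b := b) (fun t ht => by
      rw [h (a + b - t) ⟨by linarith [ht.2], by linarith [ht.1]⟩]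
      have e := intervalIntegral.integral_comp_sub_left (a := a) (b := t)
        (fun σ => ∫ r in σ..b, (N (r - σ))ᵀ *ᵥ p r) (a + b)
      rw [add_sub_cancel_left] at e
      rw [← e]
      refine intervalIntegral.integral_congr fun σ _ => ?_
      have e' := intervalIntegral.integral_comp_sub_left (a := a) (b := σ)
        (fun r => (N (r - (a + b - σ)))ᵀ *ᵥ p r) (a + b)
      rw [add_sub_cancel_left] at e'
      rw [← e']
      refine intervalIntegral.integral_congr fun r _ => ?_
      congr 3
      ring)
  intro s hs
  have := key (a + b - s) ⟨by linarith [hs.2], by linarith [hs.1]⟩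
  simpa using this

/-! ### Square-integrable histories and the memory term -/

theorem IsL2.intervalIntegrable {k : ℕ} {a b : ℝ} {f : ℝ → Fin k → ℝ} (hf : IsL2 a b f)
    (hab : a ≤ b) : IntervalIntegrable f volume a b :=
  (intervalIntegrable_iff_integrableOn_Ioc_of_le hab).2 (MemLp.integrable one_le_two hf)

theorem IsL2.intervalIntegrable_dotProduct_self {k : ℕ} {a b : ℝ} {f : ℝ → Fin k → ℝ}
    (hf : IsL2 a b f) (hab : a ≤ b) : IntervalIntegrable (fun t => f t ⬝ᵥ f t) volume a b := by
  rw [intervalIntegrable_iff_integrableOn_Ioc_of_le hab]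
  simp only [dotProduct]
  refine integrable_finsetSum _ fun i _ => ?_
  have h : MemLp (fun t => f t i) 2 (volume.restrict (Ioc a b)) :=
    (ContinuousLinearMap.proj (R := ℝ) (φ := fun _ : Fin k => ℝ) i).comp_memLp' hf
  simpa [sq] using h.integrable_sq

theorem isL2_of_continuousOn {k : ℕ} {a b : ℝ} {f : ℝ → Fin k → ℝ}
    (hf : ContinuousOn f (Icc a b)) : IsL2 a b f := by
  obtain ⟨C, hC⟩ := isCompact_Icc.exists_bound_of_continuousOn hf
  refine MemLp.of_bound
    ((hf.mono Ioc_subset_Icc_self).aestronglyMeasurable measurableSet_Ioc) C ?_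
  filter_upwards [ae_restrict_mem measurableSet_Ioc] with t ht
  exact hC t (Ioc_subset_Icc_self ht)

/-- Makes the path up to time `t` a legitimate history when the problem is restarted at `t`. -/
theorem isL2_extendBy {τ t : ℝ} {xt x : ℝ → Fin n → ℝ}
    (hxt : IsL2 0 τ xt) (hx : Continuous x) : IsL2 0 t (extendBy τ xt x) := by
  have h1 : MemLp (extendBy τ xt x) 2 (volume.restrict (Ioo 0 τ)) := by
    refine (memLp_congr_ae ?_).2 (hxt.mono_measure (Measure.restrict_mono Ioo_subset_Ioc_self le_rfl))
    filter_upwards [ae_restrict_mem measurableSet_Ioo] with s hs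
    simp [extendBy, hs.2]
  have h2 : MemLp (extendBy τ xt x) 2 (volume.restrict (Icc τ t)) := by
    have := isL2_of_continuousOn (a := τ) (b := t) hx.continuousOn
    rw [IsL2, Measure.restrict_congr_set Ioc_ae_eq_Icc] at this
    refine (memLp_congr_ae ?_).2 this
    filter_upwards [ae_restrict_mem measurableSet_Icc] with s hs
    simp [extendBy, hs.1]
  refine (MemLp.piecewise (s := Iio τ) (f := extendBy τ xt x) (g := extendBy τ xt x)
    measurableSet_Iio (μ := volume.restrict (Ioc 0 t)) (p := 2) ?_ ?_).ae_eq ?_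
  · rw [Measure.restrict_restrict measurableSet_Iio]
    exact h1.mono_measure (Measure.restrict_mono (show Iio τ ∩ Ioc 0 t ⊆ Ioo 0 τ from
      fun s hs => ⟨hs.2.1, hs.1⟩) le_rfl)
  · rw [Measure.restrict_restrict measurableSet_Iio.compl]
    exact h2.mono_measure (Measure.restrict_mono (show (Iio τ)ᶜ ∩ Ioc 0 t ⊆ Icc τ t from
      fun s hs => ⟨not_lt.1 hs.1, hs.2.2⟩) le_rfl)
  · simp

/-- The inhomogeneity produced by the history `xt`. -/
noncomputable def memory (N : ℝ → Matrix (Fin n) (Fin n) ℝ) (τ : ℝ) (xt : ℝ → Fin n → ℝ)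
    (σ : ℝ) : Fin n → ℝ :=
  ∫ s in (0 : ℝ)..τ, N (σ - s) *ᵥ xt s

theorem intervalIntegrable_clm_apply {F G : Type*} [NormedAddCommGroup F] [NormedSpace ℝ F]
    [NormedAddCommGroup G] [NormedSpace ℝ G] {a b : ℝ} {L : ℝ → F →L[ℝ] G} (hL : Continuous L)
    {f : ℝ → F} (hf : IntervalIntegrable f volume a b) :
    IntervalIntegrable (fun s => L s (f s)) volume a b := by
  obtain ⟨C, hC⟩ := (isCompact_uIcc (a := a) (b := b)).exists_bound_of_continuousOn hL.continuousOn
  rw [intervalIntegrable_iff] at hf ⊢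
  refine Integrable.mono' (hf.norm.const_mul C) ?_ ?_
  · exact ContinuousLinearMap.aestronglyMeasurable_comp₂
      (ContinuousLinearMap.id ℝ (F →L[ℝ] G))
      (hL.continuousOn.aestronglyMeasurable measurableSet_uIoc) hf.aestronglyMeasurable
  · filter_upwards [ae_restrict_mem measurableSet_uIoc] with s hs
    exact ((L s).le_opNorm _).trans
      (mul_le_mul_of_nonneg_right (hC s (uIoc_subset_uIcc hs)) (norm_nonneg _))

theorem intervalIntegrable_convolution {N : ℝ → Matrix (Fin n) (Fin n) ℝ} (hN : Continuous N)
    {a b : ℝ} {f : ℝ → Fin n → ℝ} (hf : IntervalIntegrable f volume a b) (σ : ℝ) :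
    IntervalIntegrable (fun s => N (σ - s) *ᵥ f s) volume a b :=
  intervalIntegrable_clm_apply (L := fun s => mulVecCLM (N (σ - s)))
    (continuous_mulVecCLM.comp (by fun_prop)) hf

/-- Dominated convergence: the history is merely integrable, and only `N` carries the dependence on
`σ`. -/
theorem continuous_memory {N : ℝ → Matrix (Fin n) (Fin n) ℝ} (hN : Continuous N) {τ : ℝ}
    {xt : ℝ → Fin n → ℝ} (hxt : IntervalIntegrable xt volume 0 τ) : Continuous (memory N τ xt) := by
  rw [continuous_iff_continuousAt]
  intro σ₀
  have hc : ContinuousOn (fun q : ℝ × ℝ => mulVecCLM (N (q.1 - q.2)))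
      (Icc (σ₀ - 1) (σ₀ + 1) ×ˢ uIcc 0 τ) :=
    (continuous_mulVecCLM.comp (by fun_prop)).continuousOn
  obtain ⟨C, hC⟩ := (isCompact_Icc.prod isCompact_uIcc).exists_bound_of_continuousOn hc
  refine intervalIntegral.continuousAt_of_dominated_interval (bound := fun s => C * ‖xt s‖) ?_ ?_
    (hxt.norm.const_mul C) ?_
  · refine Filter.Eventually.of_forall fun σ => ?_
    exact (intervalIntegrable_iff.1 (intervalIntegrable_convolution hN hxt σ)).aestronglyMeasurable
  · filter_upwards [Icc_mem_nhds (show σ₀ - 1 < σ₀ by linarith) (show σ₀ < σ₀ + 1 by linarith)]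
      with σ hσ
    refine Filter.Eventually.of_forall fun s hs => ?_
    exact ((mulVecCLM (N (σ - s))).le_opNorm _).trans
      (mul_le_mul_of_nonneg_right (hC (σ, s) ⟨hσ, uIoc_subset_uIcc hs⟩) (norm_nonneg _))
  · refine Filter.Eventually.of_forall fun s _ => ?_
    exact Continuous.continuousAt (by fun_prop)

/-- On restarting at `t`, the part of the convolution over `[τ, t]` becomes memory; this is what
`IsExtremal.restrict` needs. -/
theorem memory_extendBy {N : ℝ → Matrix (Fin n) (Fin n) ℝ} (hN : Continuous N) {τ t : ℝ}
    (hτ : 0 ≤ τ) (ht : τ ≤ t) {xt x : ℝ → Fin n → ℝ} (hxt : IsL2 0 τ xt) (hx : Continuous x)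
    (σ : ℝ) :
    memory N t (extendBy τ xt x) σ = memory N τ xt σ + ∫ s in τ..t, N (σ - s) *ᵥ x s := by
  have hint := intervalIntegrable_convolution hN
    ((isL2_extendBy hxt hx).intervalIntegrable (hτ.trans ht)) σ
  rw [memory, ← intervalIntegral.integral_add_adjacent_intervals (b := τ)
    (hint.mono_set (uIcc_subset_uIcc_left (mem_uIcc_of_le hτ ht)))
    (hint.mono_set (uIcc_subset_uIcc_right (mem_uIcc_of_le hτ ht)))]
  congr 1
  · refine intervalIntegral.integral_congr_ae ?_
    -- At `s = τ` the extension already takes the value of `x`, so this point is discarded as a null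
    -- set.
    filter_upwards [compl_mem_ae_iff.2 (measure_singleton τ)] with s hs hs'
    rw [uIoc_of_le hτ] at hs'
    have : s < τ := lt_of_le_of_ne hs'.2 hs
    simp [extendBy, this]
  · refine intervalIntegral.integral_congr fun s hs => ?_
    rw [uIcc_of_le ht] at hs
    simp [extendBy, not_lt.2 hs.1]

/-! ### Independence of irrelevant values -/

/-- A trajectory only depends on the values of `N` on `[0, T]` and of `x` on `[τ, T]`. -/
theorem IsTrajectory.congr {T τ : ℝ} (hτ : τ ∈ Icc 0 T) {N N' : ℝ → Matrix (Fin n) (Fin n) ℝ}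
    (hN : EqOn N N' (Icc 0 T)) {B : Matrix (Fin n) (Fin m) ℝ} {xh : Fin n → ℝ}
    {xt x x' : ℝ → Fin n → ℝ} {u : ℝ → Fin m → ℝ} (hx : EqOn x x' (Icc τ T))
    (h : IsTrajectory T N B τ xh xt u x) : IsTrajectory T N' B τ xh xt u x' := by
  refine ⟨h.1.congr hx.symm, fun t ht => ?_⟩
  rw [← hx ht, h.2 t ht]
  congr 1
  refine intervalIntegral.integral_congr fun σ hσ => ?_
  rw [uIcc_of_le ht.1] at hσ
  have hσT := hσ.2.trans ht.2
  refine congrArg₂ (· + ·) (congrArg₂ (· + ·) ?_ rfl) ?_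
  · refine intervalIntegral.integral_congr fun s hs => ?_
    rw [uIcc_of_le hσ.1] at hs
    rw [hN ⟨by linarith [hs.2], by linarith [hs.1, hτ.1]⟩, hx ⟨hs.1, hs.2.trans hσT⟩]
  · refine intervalIntegral.integral_congr fun s hs => ?_
    rw [uIcc_of_le hτ.1] at hs
    rw [hN ⟨by linarith [hs.2, hσ.1], by linarith [hs.1]⟩]

theorem cost_congr {T τ : ℝ} (hτ : τ ≤ T) {Q Q₀ : Matrix (Fin n) (Fin n) ℝ}
    {u : ℝ → Fin m → ℝ} {x x' : ℝ → Fin n → ℝ} (hx : EqOn x x' (Icc τ T)) :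
    cost T Q Q₀ τ u x = cost T Q Q₀ τ u x' := by
  rw [cost, cost, hx ⟨hτ, le_rfl⟩]
  congr 1
  refine intervalIntegral.integral_congr fun t ht => ?_
  rw [uIcc_of_le hτ] at ht
  rw [hx ht]

/-- Allows a trajectory to be taken continuous on the whole line, as the duality identity requires.
-/
theorem IsAdmissiblePair.exists_continuous {T τ : ℝ} (hτ : τ ∈ Icc 0 T)
    {N : ℝ → Matrix (Fin n) (Fin n) ℝ} {B : Matrix (Fin n) (Fin m) ℝ} {xh : Fin n → ℝ}
    {xt y : ℝ → Fin n → ℝ} {v : ℝ → Fin m → ℝ} (h : IsAdmissiblePair T N B τ xh xt v y) :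
    ∃ y', Continuous y' ∧ EqOn y y' (Icc τ T) ∧ IsAdmissiblePair T N B τ xh xt v y' := by
  have hEq : EqOn y (IccExtend hτ.2 ((Icc τ T).domRestrict y)) (Icc τ T) := fun t ht => by
    rw [IccExtend_of_mem _ _ ht, domRestrict_apply]
  exact ⟨_, (continuousOn_iff_continuous_domRestrict.1 h.2.1).Icc_extend', hEq, h.1,
    h.2.congr hτ (fun _ _ => rfl) hEq⟩

/-! ### Extremals: duality, optimality and uniqueness -/

/-- `x` and `p` solve the state and costate equations on `[τ, T]`, the control being
`-Bᵀ *ᵥ p`. -/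
structure IsExtremal (T : ℝ) (N : ℝ → Matrix (Fin n) (Fin n) ℝ) (B : Matrix (Fin n) (Fin m) ℝ)
    (Q Q₀ : Matrix (Fin n) (Fin n) ℝ) (τ : ℝ) (xh : Fin n → ℝ) (xt x p : ℝ → Fin n → ℝ) :
    Prop where
  continuous_state : Continuous x
  continuous_costate : Continuous p
  state_eq : ∀ t ∈ Icc τ T, x t = xh + ∫ σ in τ..t,
    ((∫ s in τ..σ, N (σ - s) *ᵥ x s) + B *ᵥ (-(Bᵀ *ᵥ p σ)) + memory N τ xt σ)
  costate_eq : ∀ s ∈ Icc τ T, p s = Q₀ *ᵥ x T + ∫ σ in s..T,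
    (Q *ᵥ x σ + ∫ r in σ..T, (N (r - σ))ᵀ *ᵥ p r)

/-- The bilinear form polarizing the cost along extremals. -/
noncomputable def pairing (T : ℝ) (B : Matrix (Fin n) (Fin m) ℝ)
    (Q Q₀ : Matrix (Fin n) (Fin n) ℝ) (τ : ℝ) (x p y q : ℝ → Fin n → ℝ) : ℝ :=
  (∫ t in τ..T, (x t ⬝ᵥ Q *ᵥ y t + (Bᵀ *ᵥ p t) ⬝ᵥ (Bᵀ *ᵥ q t))) + x T ⬝ᵥ Q₀ *ᵥ y T

theorem dotProduct_mulVec_comm_of_isHermitian {Q : Matrix (Fin n) (Fin n) ℝ} (hQ : Q.IsHermitian)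
    (x y : Fin n → ℝ) : x ⬝ᵥ Q *ᵥ y = y ⬝ᵥ Q *ᵥ x := by
  have : Qᵀ = Q := by simpa [IsHermitian, conjTranspose_eq_transpose_of_trivial] using hQ
  rw [dotProduct_mulVec, ← mulVec_transpose, this, dotProduct_comm]

theorem dotProduct_self_nonneg_real (x : Fin n → ℝ) : 0 ≤ x ⬝ᵥ x :=
  Finset.sum_nonneg fun _ _ => mul_self_nonneg _

theorem dotProduct_mulVec_self_nonneg {Q : Matrix (Fin n) (Fin n) ℝ} (hQ : Q.PosSemidef)
    (x : Fin n → ℝ) : 0 ≤ x ⬝ᵥ Q *ᵥ x := by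
  simpa using hQ.dotProduct_mulVec_nonneg x

section

variable {T τ : ℝ} {N : ℝ → Matrix (Fin n) (Fin n) ℝ} {B : Matrix (Fin n) (Fin m) ℝ}
  {Q Q₀ : Matrix (Fin n) (Fin n) ℝ} {xh : Fin n → ℝ} {xt x p : ℝ → Fin n → ℝ}

theorem IsExtremal.isAdmissiblePair (h : IsExtremal T N B Q Q₀ τ xh xt x p) :
    IsAdmissiblePair T N B τ xh xt (fun t => -(Bᵀ *ᵥ p t)) x := by
  have := h.continuous_costate
  exact ⟨isL2_of_continuousOn (Continuous.continuousOn (by fun_prop)),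
    h.continuous_state.continuousOn, h.state_eq⟩

theorem cost_eq_pairing : cost T Q Q₀ τ (fun t => -(Bᵀ *ᵥ p t)) x = pairing T B Q Q₀ τ x p x p := by
  simp [cost, pairing]

/-- The costate at time `τ` is half the gradient of the value in the direction of `xh`. -/
theorem IsExtremal.pairing_eq (hτ : τ ≤ T) (hN : Continuous N)
    (h : IsExtremal T N B Q Q₀ τ xh xt x p) {η : Fin n → ℝ} {y q : ℝ → Fin n → ℝ}
    (h' : IsExtremal T N B Q Q₀ τ η 0 y q) : pairing T B Q Q₀ τ y q x p = η ⬝ᵥ p τ := by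
  have hx := h.continuous_state
  have hp := h.continuous_costate
  have hy := h'.continuous_state
  have hq := h'.continuous_costate
  -- The zero history makes `y` a memoryless trajectory forced by its own control, which is tested
  -- against the costate `p` of the other extremal.
  have key := state_costate_duality hτ hN (H := fun t => Q *ᵥ x t) (z := fun t => B *ᵥ -(Bᵀ *ᵥ q t))
    (h := η) (c := Q₀ *ᵥ x T) (by fun_prop) hp hy (Continuous.intervalIntegrable (by fun_prop) _ _)
    (fun t ht => by simpa [memory] using h'.state_eq t ht) h.costate_eq
  have e : ∫ t in τ..T, (y t ⬝ᵥ Q *ᵥ x t + (Bᵀ *ᵥ q t) ⬝ᵥ (Bᵀ *ᵥ p t))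
      = (∫ t in τ..T, y t ⬝ᵥ Q *ᵥ x t) - ∫ t in τ..T, p t ⬝ᵥ B *ᵥ -(Bᵀ *ᵥ q t) := by
    rw [← intervalIntegral.integral_sub]
    · refine intervalIntegral.integral_congr fun t _ => ?_
      simp only [mulVec_neg, dotProduct_neg, sub_neg_eq_add]
      rw [dotProduct_mulVec (p t), ← mulVec_transpose, dotProduct_comm (Bᵀ *ᵥ p t)]
    · exact Continuous.intervalIntegrable (by fun_prop) _ _
    · exact Continuous.intervalIntegrable (by fun_prop) _ _
  rw [pairing, e]
  linarith

/-- An extremal remains an extremal after restriction to `[t, T]`. -/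
theorem IsExtremal.restrict (hτ : 0 ≤ τ) (hN : Continuous N) (hxt : IsL2 0 τ xt)
    (h : IsExtremal T N B Q Q₀ τ xh xt x p) {t : ℝ} (ht : t ∈ Icc τ T) :
    IsExtremal T N B Q Q₀ t (x t) (extendBy τ xt x) x p := by
  have hx := h.continuous_state
  have hp := h.continuous_costate
  -- The costate equation runs backward from `T`, so it is inherited unchanged; only the state
  -- equation has to be rearranged.
  refine ⟨hx, hp, fun r hr => ?_, fun s hs => h.costate_eq s ⟨ht.1.trans hs.1, hs.2⟩⟩
  have hF := continuous_forward_convolution hN hx τ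
  have hM := continuous_memory hN (hxt.intervalIntegrable hτ)
  have hint : ∀ a b, IntervalIntegrable (fun σ => (∫ s in τ..σ, N (σ - s) *ᵥ x s)
      + B *ᵥ (-(Bᵀ *ᵥ p σ)) + memory N τ xt σ) volume a b := fun a b =>
    Continuous.intervalIntegrable (by fun_prop) a b
  rw [h.state_eq r ⟨ht.1.trans hr.1, hr.2⟩, h.state_eq t ht,
    ← intervalIntegral.integral_add_adjacent_intervals (hint τ t) (hint t r), add_assoc]
  congr 2
  refine intervalIntegral.integral_congr fun σ _ => ?_
  rw [memory_extendBy hN hτ ht.1 hxt hx, ← intervalIntegral.integral_add_adjacent_intervals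
    (b := t) (c := σ) (Continuous.intervalIntegrable (by fun_prop) _ _)
    (Continuous.intervalIntegrable (by fun_prop) _ _)]
  abel

/-- The cost of an arbitrary admissible pair, expanded around an extremal. -/
theorem IsExtremal.cost_eq (hτ : τ ∈ Icc 0 T) (hN : Continuous N) (hQ : Q.IsHermitian)
    (hQ₀ : Q₀.IsHermitian) (hxt : IsL2 0 τ xt)
    (h : IsExtremal T N B Q Q₀ τ xh xt x p) {v : ℝ → Fin m → ℝ} {y : ℝ → Fin n → ℝ}
    (hy : Continuous y) (hvy : IsAdmissiblePair T N B τ xh xt v y) :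
    (∀ t ∈ Icc τ T, y t - x t = ∫ σ in τ..t,
      ((∫ s in τ..σ, N (σ - s) *ᵥ (y s - x s)) + B *ᵥ (v σ - -(Bᵀ *ᵥ p σ)))) ∧
    IntervalIntegrable (fun t => (y t - x t) ⬝ᵥ Q *ᵥ (y t - x t)
      + (v t - -(Bᵀ *ᵥ p t)) ⬝ᵥ (v t - -(Bᵀ *ᵥ p t))) volume τ T ∧
    cost T Q Q₀ τ v y = cost T Q Q₀ τ (fun t => -(Bᵀ *ᵥ p t)) x
      + (∫ t in τ..T, ((y t - x t) ⬝ᵥ Q *ᵥ (y t - x t)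
        + (v t - -(Bᵀ *ᵥ p t)) ⬝ᵥ (v t - -(Bᵀ *ᵥ p t))))
      + (y T - x T) ⬝ᵥ Q₀ *ᵥ (y T - x T) := by
  have hx := h.continuous_state
  have hp := h.continuous_costate
  have hM := continuous_memory hN (hxt.intervalIntegrable hτ.1)
  have hu : Continuous fun t => -(Bᵀ *ᵥ p t) := by fun_prop
  set u : ℝ → Fin m → ℝ := fun t => -(Bᵀ *ᵥ p t) with hu_def
  have hv := hvy.1.intervalIntegrable hτ.2
  have he : IsL2 τ T (fun t => v t - u t) := MemLp.sub hvy.1 (isL2_of_continuousOn hu.continuousOn)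
  have hei := he.intervalIntegrable hτ.2
  have hFx := continuous_forward_convolution hN hx τ
  have hFy := continuous_forward_convolution hN hy τ
  have hd : ∀ t ∈ Icc τ T, y t - x t = ∫ σ in τ..t,
      ((∫ s in τ..σ, N (σ - s) *ᵥ (y s - x s)) + B *ᵥ (v σ - u σ)) := by
    intro t ht
    rw [hvy.2.2 t ht, h.state_eq t ht, add_sub_add_left_eq_sub, ← intervalIntegral.integral_sub]
    · refine intervalIntegral.integral_congr fun σ _ => ?_
      simp only [mulVec_sub]
      rw [intervalIntegral.integral_sub (Continuous.intervalIntegrable (by fun_prop) _ _)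
        (Continuous.intervalIntegrable (by fun_prop) _ _)]
      simp only [memory, hu_def]
      abel
    · have hvt : IntervalIntegrable v volume τ t :=
        hv.mono_set (by rw [uIcc_of_le hτ.2, uIcc_of_le ht.1]; exact Icc_subset_Icc_right ht.2)
      exact ((hFy.intervalIntegrable _ _).add (intervalIntegrable_mulVec B hvt)).add
        (hM.intervalIntegrable _ _)
    · exact Continuous.intervalIntegrable (by fun_prop) _ _
  have hpos : IntervalIntegrable (fun t => (y t - x t) ⬝ᵥ Q *ᵥ (y t - x t)
      + (v t - u t) ⬝ᵥ (v t - u t)) volume τ T :=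
    (Continuous.intervalIntegrable (by fun_prop) _ _).add
      (he.intervalIntegrable_dotProduct_self hτ.2)
  refine ⟨hd, hpos, ?_⟩
  -- First-order condition: `y - x` starts from zero and has no memory, since both trajectories
  -- share the state. Duality with `p` then makes the running cross terms cancel the terminal one.
  have key := state_costate_duality hτ.2 hN (H := fun t => Q *ᵥ x t) (y := fun t => y t - x t)
    (z := fun t => B *ᵥ (v t - u t)) (h := 0) (c := Q₀ *ᵥ x T) (by fun_prop) hp (by fun_prop)
    (intervalIntegrable_mulVec B hei) (fun t ht => by simpa using hd t ht) h.costate_eq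
  have hpe : IntervalIntegrable (fun t => p t ⬝ᵥ B *ᵥ (v t - u t)) volume τ T :=
    intervalIntegrable_dotProduct hp (intervalIntegrable_mulVec B hei)
  have hxx : IntervalIntegrable (fun t => x t ⬝ᵥ Q *ᵥ x t + u t ⬝ᵥ u t) volume τ T :=
    Continuous.intervalIntegrable (by fun_prop) _ _
  have hdx : IntervalIntegrable (fun t => (y t - x t) ⬝ᵥ Q *ᵥ x t) volume τ T :=
    Continuous.intervalIntegrable (by fun_prop) _ _
  have e : ∫ t in τ..T, (y t ⬝ᵥ Q *ᵥ y t + v t ⬝ᵥ v t)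
      = (∫ t in τ..T, (x t ⬝ᵥ Q *ᵥ x t + u t ⬝ᵥ u t))
        + (∫ t in τ..T, ((y t - x t) ⬝ᵥ Q *ᵥ (y t - x t) + (v t - u t) ⬝ᵥ (v t - u t)))
        + 2 * ((∫ t in τ..T, (y t - x t) ⬝ᵥ Q *ᵥ x t)
          - ∫ t in τ..T, p t ⬝ᵥ B *ᵥ (v t - u t)) := by
    rw [← intervalIntegral.integral_sub hdx hpe, ← intervalIntegral.integral_const_mul,
      ← intervalIntegral.integral_add hxx hpos,
      ← intervalIntegral.integral_add (hxx.add hpos) ((hdx.sub hpe).const_mul 2)]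
    refine intervalIntegral.integral_congr fun t _ => ?_
    have e1 : p t ⬝ᵥ B *ᵥ (v t - u t) = - (u t ⬝ᵥ (v t - u t)) := by
      rw [dotProduct_mulVec, ← mulVec_transpose, hu_def, neg_dotProduct, neg_neg]
    have e2 := dotProduct_mulVec_comm_of_isHermitian hQ (x t) (y t)
    have e3 := dotProduct_comm (u t) (v t)
    simp only [e1]
    simp only [mulVec_sub, dotProduct_sub, sub_dotProduct]
    linarith
  have e2 := dotProduct_mulVec_comm_of_isHermitian hQ₀ (x T) (y T)
  rw [cost, cost, e]
  simp only [mulVec_sub, dotProduct_sub, sub_dotProduct, zero_dotProduct, zero_add] at key ⊢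
  linarith

theorem IsExtremal.cost_le (hτ : τ ∈ Icc 0 T) (hN : Continuous N) (hQ : Q.PosSemidef)
    (hQ₀ : Q₀.PosSemidef) (hxt : IsL2 0 τ xt)
    (h : IsExtremal T N B Q Q₀ τ xh xt x p) {v : ℝ → Fin m → ℝ} {y : ℝ → Fin n → ℝ}
    (hvy : IsAdmissiblePair T N B τ xh xt v y) :
    cost T Q Q₀ τ (fun t => -(Bᵀ *ᵥ p t)) x ≤ cost T Q Q₀ τ v y := by
  obtain ⟨y', hy', hyy', hvy'⟩ := hvy.exists_continuous hτ
  rw [cost_congr hτ.2 hyy', (h.cost_eq hτ hN hQ.1 hQ₀.1 hxt hy' hvy').2.2]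
  have h1 : 0 ≤ ∫ t in τ..T, ((y' t - x t) ⬝ᵥ Q *ᵥ (y' t - x t)
        + (v t - -(Bᵀ *ᵥ p t)) ⬝ᵥ (v t - -(Bᵀ *ᵥ p t))) :=
    intervalIntegral.integral_nonneg hτ.2 fun t _ =>
      add_nonneg (dotProduct_mulVec_self_nonneg hQ _) (dotProduct_self_nonneg_real _)
  have h2 := dotProduct_mulVec_self_nonneg hQ₀ (y' T - x T)
  linarith

theorem IsExtremal.isOptimalPair (hτ : τ ∈ Icc 0 T) (hN : Continuous N) (hQ : Q.PosSemidef)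
    (hQ₀ : Q₀.PosSemidef) (hxt : IsL2 0 τ xt) (h : IsExtremal T N B Q Q₀ τ xh xt x p) :
    IsOptimalPair T N B Q Q₀ τ xh xt (fun t => -(Bᵀ *ᵥ p t)) x :=
  ⟨h.isAdmissiblePair, fun _ _ hvy => h.cost_le hτ hN hQ hQ₀ hxt hvy⟩

theorem IsExtremal.valueFunction_eq (hτ : τ ∈ Icc 0 T) (hN : Continuous N) (hQ : Q.PosSemidef)
    (hQ₀ : Q₀.PosSemidef) (hxt : IsL2 0 τ xt) (h : IsExtremal T N B Q Q₀ τ xh xt x p) :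
    valueFunction T N B Q Q₀ τ xh xt = pairing T B Q Q₀ τ x p x p := by
  rw [← cost_eq_pairing]
  refine IsLeast.csInf_eq ⟨⟨_, _, h.isAdmissiblePair, rfl⟩, ?_⟩
  rintro c ⟨v, y, hvy, rfl⟩
  exact h.cost_le hτ hN hQ hQ₀ hxt hvy

/-- Optimality of `v` forces the nonnegative excess cost to vanish, hence `v = u` almost everywhere.
Then `y - x` solves the homogeneous forward equation and vanishes. -/
theorem IsExtremal.unique (hτ : τ ∈ Icc 0 T) (hN : Continuous N) (hQ : Q.PosSemidef)
    (hQ₀ : Q₀.PosSemidef) (hxt : IsL2 0 τ xt)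
    (h : IsExtremal T N B Q Q₀ τ xh xt x p) {v : ℝ → Fin m → ℝ} {y : ℝ → Fin n → ℝ}
    (hvy : IsOptimalPair T N B Q Q₀ τ xh xt v y) :
    v =ᵐ[volume.restrict (Ioc τ T)] (fun t => -(Bᵀ *ᵥ p t)) ∧ EqOn y x (Icc τ T) := by
  obtain ⟨y', hy', hyy', hvy'⟩ := hvy.1.exists_continuous hτ
  have hle := hvy.2 _ _ h.isAdmissiblePair
  obtain ⟨hd, hint, hcost⟩ := h.cost_eq hτ hN hQ.1 hQ₀.1 hxt hy' hvy'
  rw [cost_congr hτ.2 hyy', hcost] at hle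
  have hnn : ∀ t, 0 ≤ (y' t - x t) ⬝ᵥ Q *ᵥ (y' t - x t)
        + (v t - -(Bᵀ *ᵥ p t)) ⬝ᵥ (v t - -(Bᵀ *ᵥ p t)) := fun t =>
    add_nonneg (dotProduct_mulVec_self_nonneg hQ _) (dotProduct_self_nonneg_real _)
  have h1 := intervalIntegral.integral_nonneg (μ := volume) hτ.2 fun t _ => hnn t
  have h2 := dotProduct_mulVec_self_nonneg hQ₀ (y' T - x T)
  have h0 : ∫ t in τ..T, ((y' t - x t) ⬝ᵥ Q *ᵥ (y' t - x t)
        + (v t - -(Bᵀ *ᵥ p t)) ⬝ᵥ (v t - -(Bᵀ *ᵥ p t))) = 0 := by linarith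
  rw [intervalIntegral.integral_eq_zero_iff_of_le_of_nonneg_ae hτ.2
    (Filter.Eventually.of_forall hnn) hint] at h0
  have hv : v =ᵐ[volume.restrict (Ioc τ T)] (fun t => -(Bᵀ *ᵥ p t)) := by
    filter_upwards [h0] with t ht
    have := dotProduct_mulVec_self_nonneg hQ (y' t - x t)
    have h3 := dotProduct_self_nonneg_real (v t - -(Bᵀ *ᵥ p t))
    simp only [Pi.zero_apply] at ht
    exact sub_eq_zero.1 (dotProduct_self_eq_zero.1 (by linarith))
  refine ⟨hv, fun t ht => ?_⟩
  have hx := h.continuous_state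
  rw [hyy' ht]
  refine sub_eq_zero.1 (forward_eq_zero hN (x := fun t => y' t - x t) (by fun_prop)
    (fun t ht => ?_) t ht)
  rw [hd t ht]
  refine intervalIntegral.integral_congr_ae ?_
  filter_upwards [(ae_restrict_iff' measurableSet_Ioc).1 hv] with σ hσ hσ'
  rw [uIoc_of_le ht.1] at hσ'
  simp [hσ ⟨hσ'.1, hσ'.2.trans ht.2⟩]

/-- Equality of the controls only gives `Bᵀ *ᵥ q = Bᵀ *ᵥ p`. The states agree as well, so `q - p`
solves the homogeneous backward equation. -/
theorem IsExtremal.costate_unique (hτ : τ ∈ Icc 0 T) (hN : Continuous N) (hQ : Q.PosSemidef)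
    (hQ₀ : Q₀.PosSemidef) (hxt : IsL2 0 τ xt) (h : IsExtremal T N B Q Q₀ τ xh xt x p)
    {y q : ℝ → Fin n → ℝ} (h' : IsExtremal T N B Q Q₀ τ xh xt y q) : EqOn q p (Icc τ T) := by
  have hxy := (h.unique hτ hN hQ hQ₀ hxt (h'.isOptimalPair hτ hN hQ hQ₀ hxt)).2
  have hp := h.continuous_costate
  have hq := h'.continuous_costate
  have hx := h.continuous_state
  have hy := h'.continuous_state
  have hGp := continuous_backward_convolution hN hp T
  have hGq := continuous_backward_convolution hN hq T
  intro s hs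
  refine sub_eq_zero.1 (backward_eq_zero hN (p := fun t => q t - p t) (by fun_prop)
    (fun s hs => ?_) s hs)
  rw [h.costate_eq s hs, h'.costate_eq s hs, hxy ⟨hτ.2, le_rfl⟩, add_sub_add_left_eq_sub,
    ← intervalIntegral.integral_sub]
  · refine intervalIntegral.integral_congr fun σ hσ => ?_
    rw [uIcc_of_le hs.2] at hσ
    simp only [mulVec_sub]
    rw [hxy ⟨hs.1.trans hσ.1, hσ.2⟩, add_sub_add_left_eq_sub,
      intervalIntegral.integral_sub (Continuous.intervalIntegrable (by fun_prop) _ _)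
        (Continuous.intervalIntegrable (by fun_prop) _ _)]
  · exact Continuous.intervalIntegrable (by fun_prop) _ _
  · exact Continuous.intervalIntegrable (by fun_prop) _ _

end

/-! ### Integral operators on continuous paths -/

section

variable {T : ℝ}

/-- Continuous paths on `[0, T]`. -/
abbrev Path (n : ℕ) (T : ℝ) := C(Icc (0 : ℝ) T, Fin n → ℝ)

/-- Continuous kernels on `[0, T] × [0, T]`. -/
abbrev PathKernel (n : ℕ) (T : ℝ) :=
  C(Icc (0 : ℝ) T × Icc (0 : ℝ) T, (Fin n → ℝ) →L[ℝ] (Fin n → ℝ))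

/-- The constant extension of a path to the real line. -/
noncomputable def Path.extend (hT : 0 ≤ T) (x : Path n T) (s : ℝ) : Fin n → ℝ := x (projIcc 0 T hT s)

@[fun_prop]
theorem Path.continuous_extend (hT : 0 ≤ T) (x : Path n T) : Continuous (x.extend hT) :=
  x.continuous.comp continuous_projIcc

theorem Path.extend_of_mem (hT : 0 ≤ T) (x : Path n T) {s : ℝ} (hs : s ∈ Icc 0 T) :
    x.extend hT s = x ⟨s, hs⟩ := by rw [extend, projIcc_of_mem hT hs]

theorem continuous_integrand (hT : 0 ≤ T) (k : PathKernel n T) :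
    Continuous (Function.uncurry fun (q : Path n T × Icc (0 : ℝ) T) (s : ℝ) =>
      k (q.2, projIcc 0 T hT s) (q.1 (projIcc 0 T hT s))) := by
  have hproj : Continuous (projIcc 0 T hT) := continuous_projIcc
  simp only [Function.uncurry_def]
  fun_prop

theorem continuous_integrand_apply (hT : 0 ≤ T) (k : PathKernel n T) (x : Path n T)
    (t : Icc (0 : ℝ) T) :
    Continuous fun s => k (t, projIcc 0 T hT s) (x.extend hT s) :=
  (continuous_integrand hT k).comp (Continuous.prodMk_right (x, t))

theorem continuous_integral_operator (hT : 0 ≤ T) (a b : C(Icc (0 : ℝ) T, ℝ))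
    (k : PathKernel n T) :
    Continuous fun q : Path n T × Icc (0 : ℝ) T => ∫ s in a q.2..b q.2,
      k (q.2, projIcc 0 T hT s) (q.1 (projIcc 0 T hT s)) := by
  have h := continuous_integrand hT k
  have e : (fun q : Path n T × Icc (0 : ℝ) T => ∫ s in a q.2..b q.2,
      k (q.2, projIcc 0 T hT s) (q.1 (projIcc 0 T hT s))) = fun q =>
      (∫ s in (0 : ℝ)..b q.2, k (q.2, projIcc 0 T hT s) (q.1 (projIcc 0 T hT s)))
      - ∫ s in (0 : ℝ)..a q.2, k (q.2, projIcc 0 T hT s) (q.1 (projIcc 0 T hT s)) := by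
    ext1 q
    rw [intervalIntegral.integral_interval_sub_left] <;>
    exact (continuous_integrand_apply hT k q.1 q.2).intervalIntegrable _ _
  rw [e]
  exact (intervalIntegral.continuous_parametric_intervalIntegral_of_continuous h (by fun_prop)).sub
    (intervalIntegral.continuous_parametric_intervalIntegral_of_continuous h (by fun_prop))

/-- The integral operator `x ↦ (t ↦ ∫_{a t}^{b t} k(t, s) x(s) ds)`. -/
noncomputable def intOp (hT : 0 ≤ T) (a b : C(Icc (0 : ℝ) T, ℝ)) (k : PathKernel n T) :
    Path n T →L[ℝ] Path n T where
  toFun x := ⟨fun t => ∫ s in a t..b t, k (t, projIcc 0 T hT s) (x (projIcc 0 T hT s)),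
    (continuous_integral_operator hT a b k).comp (Continuous.prodMk_right x)⟩
  map_add' x y := by
    ext1 t
    simp only [ContinuousMap.coe_mk, ContinuousMap.add_apply, map_add]
    exact intervalIntegral.integral_add
      ((continuous_integrand_apply hT k x t).intervalIntegrable _ _)
      ((continuous_integrand_apply hT k y t).intervalIntegrable _ _)
  map_smul' c x := by
    ext1 t
    simp only [ContinuousMap.coe_mk, ContinuousMap.smul_apply, map_smul, RingHom.id_apply]
    exact intervalIntegral.integral_smul _ _
  cont := ContinuousMap.continuous_of_continuous_uncurry _ (continuous_integral_operator hT a b k)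

theorem intOp_apply (hT : 0 ≤ T) (a b : C(Icc (0 : ℝ) T, ℝ)) (k : PathKernel n T)
    (x : Path n T) (t : Icc (0 : ℝ) T) :
    intOp hT a b k x t = ∫ s in a t..b t, k (t, projIcc 0 T hT s) (x.extend hT s) := rfl

theorem norm_integral_kernel_le (hT : 0 ≤ T) (k : PathKernel n T) (x : Path n T)
    (t : Icc (0 : ℝ) T) (a b : ℝ) :
    ‖∫ s in a..b, k (t, projIcc 0 T hT s) (x.extend hT s)‖ ≤ ‖k‖ * ‖x‖ * |b - a| :=
  intervalIntegral.norm_integral_le_of_norm_le_const fun _ _ =>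
    ((k _).le_opNorm _).trans (mul_le_mul (k.norm_coe_le_norm _) (x.norm_coe_le_norm _)
      (norm_nonneg _) (norm_nonneg k))

/-- Moving the limits changes the integral only over the intervals between old and new endpoints.
This gives continuity in operator norm, not just strongly, as inversion requires. -/
theorem norm_intOp_sub_le (hT : 0 ≤ T) (a b a' b' : C(Icc (0 : ℝ) T, ℝ)) (k : PathKernel n T) :
    ‖intOp hT a b k - intOp hT a' b' k‖ ≤ ‖k‖ * (‖a' - a‖ + ‖b' - b‖) := by
  refine ContinuousLinearMap.opNorm_le_bound _ (by positivity) fun x => ?_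
  refine (ContinuousMap.norm_le _ (by positivity)).2 fun t => ?_
  have hi := continuous_integrand_apply hT k x t
  rw [_root_.sub_apply, ContinuousMap.sub_apply, intOp_apply, intOp_apply,
    intervalIntegral.integral_interval_sub_interval_comm (hi.intervalIntegrable _ _)
    (hi.intervalIntegrable _ _) (hi.intervalIntegrable _ _)]
  have h1 := norm_integral_kernel_le hT k x t (a t) (a' t)
  have h2 := norm_integral_kernel_le hT k x t (b t) (b' t)
  have h3 : |a' t - a t| ≤ ‖a' - a‖ := (a' - a).norm_coe_le_norm t
  have h4 : |b' t - b t| ≤ ‖b' - b‖ := (b' - b).norm_coe_le_norm t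
  have h5 : 0 ≤ ‖k‖ * ‖x‖ := by positivity
  calc _ ≤ _ := norm_sub_le _ _
    _ ≤ ‖k‖ * ‖x‖ * ‖a' - a‖ + ‖k‖ * ‖x‖ * ‖b' - b‖ :=
      add_le_add (h1.trans (mul_le_mul_of_nonneg_left h3 h5))
        (h2.trans (mul_le_mul_of_nonneg_left h4 h5))
    _ = _ := by ring

theorem continuous_intOp {X : Type*} [TopologicalSpace X] (hT : 0 ≤ T)
    {a b : X → C(Icc (0 : ℝ) T, ℝ)} (ha : Continuous a) (hb : Continuous b) (k : PathKernel n T) :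
    Continuous fun r => intOp hT (a r) (b r) k := by
  rw [continuous_iff_continuousAt]
  intro r₀
  refine (tendsto_iff_norm_sub_tendsto_zero (E := Path n T →L[ℝ] Path n T)).2 ?_
  refine squeeze_zero (fun r => norm_nonneg (intOp hT (a r) (b r) k - intOp hT (a r₀) (b r₀) k))
    (fun r => norm_intOp_sub_le hT (a r) (b r) (a r₀) (b r₀) k) ?_
  have : Continuous fun r => ‖k‖ * (‖a r₀ - a r‖ + ‖b r₀ - b r‖) := by fun_prop
  simpa using this.tendsto r₀

/-- An operator into paths whose values are Lipschitz, uniformly on bounded sets, is compact. -/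
theorem isCompactOperator_of_lipschitz {F : Type*} [NormedAddCommGroup F] [NormedSpace ℝ F]
    (f : F →L[ℝ] Path n T) (L : ℝ)
    (h : ∀ x t t', ‖f x t - f x t'‖ ≤ L * ‖x‖ * |(t : ℝ) - t'|) : IsCompactOperator f := by
  set S : Set (Path n T) := {g | (∀ t, ‖g t‖ ≤ ‖f‖) ∧ ∀ t t', ‖g t - g t'‖ ≤ |L| * |(t : ℝ) - t'|}
    with hS
  have hlip : ∀ g : Icc (0 : ℝ) T → Fin n → ℝ, (∀ t t', ‖g t - g t'‖ ≤ |L| * |(t : ℝ) - t'|) →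
      LipschitzWith ⟨|L|, abs_nonneg L⟩ g := fun g hg =>
    LipschitzWith.of_dist_le_mul fun t t' => by
      rw [dist_eq_norm, Subtype.dist_eq, Real.dist_eq]
      exact hg t t'
  refine ⟨S, ArzelaAscoli.isCompact_of_equicontinuous S ?_ ?_, ?_⟩
  -- Arzelà–Ascoli asks for compactness in the product topology: the image is a closed subset of a
  -- product of closed balls, continuity being automatic from the Lipschitz bound.
  · have e : ContinuousMap.toFun '' S = (univ.pi fun _ => Metric.closedBall 0 ‖f‖) ∩
        ⋂ (t : Icc (0 : ℝ) T) (t' : Icc (0 : ℝ) T),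
          {g : Icc (0 : ℝ) T → Fin n → ℝ | ‖g t - g t'‖ ≤ |L| * |(t : ℝ) - t'|} := by
      ext g
      simp only [mem_image, mem_inter_iff, mem_univ_pi, mem_closedBall_zero_iff, mem_iInter,
        mem_ofPred_eq]
      constructor
      · rintro ⟨g, hg, rfl⟩
        exact hg
      · rintro hg
        exact ⟨⟨g, (hlip g hg.2).continuous⟩, hg, rfl⟩
    rw [e]
    refine (isCompact_univ_pi fun _ => isCompact_closedBall _ _).inter_right ?_
    exact isClosed_iInter fun t => isClosed_iInter fun t' =>
      isClosed_le (by fun_prop) continuous_const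
  · exact (LipschitzWith.uniformEquicontinuous _ _ fun g : S => hlip _ g.2.2).equicontinuous
  · filter_upwards [Metric.closedBall_mem_nhds (0 : F) one_pos] with x hx
    rw [mem_closedBall_zero_iff] at hx
    refine ⟨fun t => ((f x).norm_coe_le_norm t).trans (f.unit_le_opNorm x hx), fun t t' => ?_⟩
    refine (h x t t').trans (mul_le_mul_of_nonneg_right ?_ (abs_nonneg _))
    calc L * ‖x‖ ≤ |L| * ‖x‖ := mul_le_mul_of_nonneg_right (le_abs_self L) (norm_nonneg _)
      _ ≤ |L| := mul_le_of_le_one_right (abs_nonneg _) hx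

/-- The kernel which is constantly the identity. -/
noncomputable def idKernel : PathKernel n T := ContinuousMap.const _ (ContinuousLinearMap.id ℝ _)

theorem isCompactOperator_intOp (hT : 0 ≤ T) {a b : C(Icc (0 : ℝ) T, ℝ)}
    (ha : ∀ t t', |a t - a t'| ≤ |(t : ℝ) - t'|) (hb : ∀ t t', |b t - b t'| ≤ |(t : ℝ) - t'|) :
    IsCompactOperator (intOp hT a b (idKernel : PathKernel n T)) := by
  refine isCompactOperator_of_lipschitz _ (‖(idKernel : PathKernel n T)‖ * 2) fun x t t' => ?_
  have hi := continuous_integrand_apply hT idKernel x t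
  -- The identity kernel does not depend on its first variable, so `t` may replace `t'` there and
  -- only the limits differ.
  have e : intOp hT a b idKernel x t' =
    ∫ s in a t'..b t', (idKernel : PathKernel n T) (t, projIcc 0 T hT s) (x.extend hT s) := rfl
  rw [e, intOp_apply, intervalIntegral.integral_interval_sub_interval_comm
    (hi.intervalIntegrable _ _) (hi.intervalIntegrable _ _) (hi.intervalIntegrable _ _)]
  have h1 := norm_integral_kernel_le hT idKernel x t (a t) (a t')
  have h2 := norm_integral_kernel_le hT idKernel x t (b t) (b t')
  rw [abs_sub_comm] at h1 h2
  have h5 : 0 ≤ ‖(idKernel : PathKernel n T)‖ * ‖x‖ := by positivity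
  calc _ ≤ _ := norm_sub_le _ _
    _ ≤ ‖(idKernel : PathKernel n T)‖ * ‖x‖ * |(t : ℝ) - t'|
        + ‖(idKernel : PathKernel n T)‖ * ‖x‖ * |(t : ℝ) - t'| :=
      add_le_add (h1.trans (mul_le_mul_of_nonneg_left (ha _ _) h5))
        (h2.trans (mul_le_mul_of_nonneg_left (hb _ _) h5))
    _ = _ := by ring

/-- The kernel `(t, s) ↦ N (t - s)`. -/
noncomputable def stateKernel {N : ℝ → Matrix (Fin n) (Fin n) ℝ} (hN : Continuous N) :
    PathKernel n T :=
  ⟨fun q => mulVecCLM (N (q.1 - q.2)), continuous_mulVecCLM.comp (by fun_prop)⟩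

/-- The kernel `(t, s) ↦ N (s - t)ᵀ`. -/
noncomputable def costateKernel {N : ℝ → Matrix (Fin n) (Fin n) ℝ} (hN : Continuous N) :
    PathKernel n T :=
  ⟨fun q => mulVecCLM (N (q.2 - q.1))ᵀ, continuous_mulVecCLM.comp (by fun_prop)⟩

/-- The forward Volterra operator started at time `τ`. -/
noncomputable def forward (hT : 0 ≤ T) (τ : Icc (0 : ℝ) T) (k : PathKernel n T) :
    Path n T →L[ℝ] Path n T :=
  -- The upper limit `max t τ` makes the image vanish on `[0, τ]`, so every `τ` is handled on the
  -- same path space.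
  intOp hT (ContinuousMap.const _ (τ : ℝ)) ⟨fun t => max (t : ℝ) τ, by fun_prop⟩ k

/-- The backward Volterra operator started at time `T`. -/
noncomputable def backward (hT : 0 ≤ T) (k : PathKernel n T) : Path n T →L[ℝ] Path n T :=
  intOp hT ⟨fun t => (t : ℝ), by fun_prop⟩ (ContinuousMap.const _ T) k

theorem continuous_forward (hT : 0 ≤ T) (k : PathKernel n T) :
    Continuous fun τ => forward hT τ k :=
  continuous_intOp hT
    (ContinuousMap.continuous_of_continuous_uncurry _ (by
      simp only [Function.uncurry_def, ContinuousMap.const_apply]; fun_prop))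
    (ContinuousMap.continuous_of_continuous_uncurry _ (by
      simp only [Function.uncurry_def, ContinuousMap.coe_mk]; fun_prop)) k

theorem isCompactOperator_forward (hT : 0 ≤ T) (τ : Icc (0 : ℝ) T) :
    IsCompactOperator (forward hT τ (idKernel : PathKernel n T)) :=
  isCompactOperator_intOp hT (fun t t' => by simp) fun t t' => by
    simpa using abs_max_sub_max_le_abs (t : ℝ) t' (τ : ℝ)

theorem isCompactOperator_backward (hT : 0 ≤ T) :
    IsCompactOperator (backward hT (idKernel : PathKernel n T)) :=
  isCompactOperator_intOp hT (fun t t' => le_rfl) fun t t' => by simp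

theorem extend_forward_idKernel (hT : 0 ≤ T) (τ : Icc (0 : ℝ) T) (y : Path n T) {t : ℝ}
    (ht : t ∈ Icc (τ : ℝ) T) :
    (forward hT τ idKernel y).extend hT t = ∫ s in (τ : ℝ)..t, y.extend hT s := by
  rw [Path.extend_of_mem hT _ ⟨τ.2.1.trans ht.1, ht.2⟩]
  simp [forward, intOp_apply, max_eq_left ht.1, idKernel]

theorem extend_forward_stateKernel (hT : 0 ≤ T) {N : ℝ → Matrix (Fin n) (Fin n) ℝ}
    (hN : Continuous N) (τ : Icc (0 : ℝ) T) (y : Path n T) {t : ℝ} (ht : t ∈ Icc (τ : ℝ) T) :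
    (forward hT τ (stateKernel hN) y).extend hT t
      = ∫ s in (τ : ℝ)..t, N (t - s) *ᵥ y.extend hT s := by
  rw [Path.extend_of_mem hT _ ⟨τ.2.1.trans ht.1, ht.2⟩]
  simp only [forward, intOp_apply, max_eq_left ht.1, stateKernel, ContinuousMap.coe_mk,
    ContinuousMap.const_apply, mulVecCLM_apply]
  refine intervalIntegral.integral_congr fun s hs => ?_
  rw [uIcc_of_le ht.1] at hs
  simp only [projIcc_of_mem hT ⟨τ.2.1.trans hs.1, hs.2.trans ht.2⟩]

theorem extend_backward_idKernel (hT : 0 ≤ T) (y : Path n T) {t : ℝ} (ht : t ∈ Icc 0 T) :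
    (backward hT idKernel y).extend hT t = ∫ s in t..T, y.extend hT s := by
  rw [Path.extend_of_mem hT _ ht]
  simp [backward, intOp_apply, idKernel]

theorem extend_backward_costateKernel (hT : 0 ≤ T) {N : ℝ → Matrix (Fin n) (Fin n) ℝ}
    (hN : Continuous N) (y : Path n T) {t : ℝ} (ht : t ∈ Icc 0 T) :
    (backward hT (costateKernel hN) y).extend hT t
      = ∫ s in t..T, (N (s - t))ᵀ *ᵥ y.extend hT s := by
  rw [Path.extend_of_mem hT _ ht]
  simp only [backward, intOp_apply, costateKernel, ContinuousMap.coe_mk,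
    ContinuousMap.const_apply, mulVecCLM_apply]
  refine intervalIntegral.integral_congr fun s hs => ?_
  rw [uIcc_of_le ht.2] at hs
  simp only [projIcc_of_mem hT ⟨ht.1.trans hs.1, hs.2⟩]

/-- Pointwise multiplication by a matrix. -/
noncomputable def mulOp (A : Matrix (Fin n) (Fin n) ℝ) : Path n T →L[ℝ] Path n T :=
  (mulVecCLM A).compLeftContinuous ℝ (Icc (0 : ℝ) T)

theorem extend_mulOp (hT : 0 ≤ T) (A : Matrix (Fin n) (Fin n) ℝ) (x : Path n T) (t : ℝ) :
    (mulOp A x).extend hT t = A *ᵥ x.extend hT t := rfl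

/-- Constant paths. -/
noncomputable def constOp : (Fin n → ℝ) →L[ℝ] Path n T :=
  LinearMap.toContinuousLinearMap
    { toFun := fun v => ContinuousMap.const _ v
      map_add' := fun _ _ => rfl
      map_smul' := fun _ _ => rfl }

@[simp]
theorem constOp_apply (v : Fin n → ℝ) (t : Icc (0 : ℝ) T) : constOp v t = v := rfl

/-- The terminal value of a path. -/
noncomputable def terminal (hT : 0 ≤ T) : Path n T →L[ℝ] (Fin n → ℝ) :=
  ContinuousMap.evalCLM ℝ ⟨T, right_mem_Icc.2 hT⟩

theorem terminal_apply (hT : 0 ≤ T) (x : Path n T) : terminal hT x = x.extend hT T := by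
  rw [Path.extend_of_mem hT _ (right_mem_Icc.2 hT)]
  rfl

/-! ### The optimality system as a Fredholm equation -/

section

variable (hT : 0 ≤ T) {N : ℝ → Matrix (Fin n) (Fin n) ℝ} (hN : Continuous N)
  (B : Matrix (Fin n) (Fin m) ℝ) (Q Q₀ : Matrix (Fin n) (Fin n) ℝ)

/-- The homogeneous part of the state equation. -/
noncomputable def stateOp (τ : Icc (0 : ℝ) T) : Path n T × Path n T →L[ℝ] Path n T :=
  (forward hT τ idKernel).comp ((forward hT τ (stateKernel hN)).comp (ContinuousLinearMap.fst ℝ _ _)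
    - (mulOp (B * Bᵀ)).comp (ContinuousLinearMap.snd ℝ _ _))

/-- The right-hand side of the costate equation. -/
noncomputable def costateOp : Path n T × Path n T →L[ℝ] Path n T :=
  (constOp.comp ((mulVecCLM Q₀).comp (terminal hT))).comp (ContinuousLinearMap.fst ℝ _ _)
    + (backward hT idKernel).comp ((mulOp Q).comp (ContinuousLinearMap.fst ℝ _ _)
      + (backward hT (costateKernel hN)).comp (ContinuousLinearMap.snd ℝ _ _))

/-- The homogeneous part of the optimality system. -/
noncomputable def systemOp (τ : Icc (0 : ℝ) T) :
    Path n T × Path n T →L[ℝ] Path n T × Path n T :=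
  (ContinuousLinearMap.inl ℝ _ _).comp (stateOp hT hN B τ)
    + (ContinuousLinearMap.inr ℝ _ _).comp (costateOp hT hN Q Q₀)

theorem systemOp_apply (τ : Icc (0 : ℝ) T) (z : Path n T × Path n T) :
    systemOp hT hN B Q Q₀ τ z = (stateOp hT hN B τ z, costateOp hT hN Q Q₀ z) := by
  simp [systemOp]

theorem continuous_systemOp : Continuous (systemOp hT hN B Q Q₀) := by
  have h1 := continuous_forward hT (idKernel : PathKernel n T)
  have h2 := continuous_forward hT (stateKernel hN : PathKernel n T)
  unfold systemOp stateOp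
  exact (continuous_const.clm_comp (h1.clm_comp
    ((h2.clm_comp continuous_const).sub continuous_const))).add continuous_const

/-- In each equation the outermost operation is a plain time integration, which is compact, applied
to a bounded operator. The terminal term has constant paths as values. -/
theorem isCompactOperator_systemOp (τ : Icc (0 : ℝ) T) :
    IsCompactOperator (systemOp hT hN B Q Q₀ τ) := by
  have h1 : IsCompactOperator (stateOp hT hN B τ) :=
    (isCompactOperator_forward hT τ).comp_clm _
  have h2 : IsCompactOperator
      ((constOp : _ →L[ℝ] Path n T).comp ((mulVecCLM Q₀).comp (terminal hT))) :=
    isCompactOperator_of_lipschitz _ 0 fun x t t' => by simp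
  have h3 : IsCompactOperator (costateOp hT hN Q Q₀) :=
    (h2.comp_clm _).add ((isCompactOperator_backward hT).comp_clm _)
  have h4 : IsCompactOperator ((ContinuousLinearMap.inl ℝ (Path n T) (Path n T)).comp
      (stateOp hT hN B τ)) := h1.clm_comp (ContinuousLinearMap.inl ℝ _ _)
  have h5 : IsCompactOperator ((ContinuousLinearMap.inr ℝ (Path n T) (Path n T)).comp
      (costateOp hT hN Q Q₀)) := h3.clm_comp (ContinuousLinearMap.inr ℝ _ _)
  exact h4.add h5

theorem extend_stateOp (τ : Icc (0 : ℝ) T) (z : Path n T × Path n T) {t : ℝ}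
    (ht : t ∈ Icc (τ : ℝ) T) : (stateOp hT hN B τ z).extend hT t = ∫ σ in (τ : ℝ)..t,
      ((∫ s in (τ : ℝ)..σ, N (σ - s) *ᵥ z.1.extend hT s) + B *ᵥ (-(Bᵀ *ᵥ z.2.extend hT σ))) := by
  rw [stateOp, ContinuousLinearMap.comp_apply, extend_forward_idKernel hT τ _ ht]
  refine intervalIntegral.integral_congr fun σ hσ => ?_
  rw [uIcc_of_le ht.1] at hσ
  have e := extend_forward_stateKernel hT hN τ z.1 ⟨hσ.1, hσ.2.trans ht.2⟩
  have e' := extend_mulOp hT (B * Bᵀ) z.2 σ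
  rw [← e, mulVec_neg, mulVec_mulVec, ← e', ← sub_eq_add_neg]
  rfl

theorem extend_costateOp (z : Path n T × Path n T) {s : ℝ} (hs : s ∈ Icc 0 T) :
    (costateOp hT hN Q Q₀ z).extend hT s = Q₀ *ᵥ z.1.extend hT T + ∫ σ in s..T,
      (Q *ᵥ z.1.extend hT σ + ∫ r in σ..T, (N (r - σ))ᵀ *ᵥ z.2.extend hT r) := by
  have e := extend_backward_idKernel hT (mulOp Q z.1 + backward hT (costateKernel hN) z.2) hs
  have e' : (costateOp hT hN Q Q₀ z).extend hT s = Q₀ *ᵥ terminal hT z.1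
    + (backward hT idKernel (mulOp Q z.1 + backward hT (costateKernel hN) z.2)).extend hT s := rfl
  rw [e', e, terminal_apply]
  congr 1
  refine intervalIntegral.integral_congr fun σ hσ => ?_
  rw [uIcc_of_le hs.2] at hσ
  rw [← extend_backward_costateKernel hT hN z.2 ⟨hs.1.trans hσ.1, hσ.2⟩]
  rfl

/-- Fixed points of the affine optimality system are extremals. -/
theorem isExtremal_of_fixedPoint (τ : Icc (0 : ℝ) T) {xh : Fin n → ℝ} {xt : ℝ → Fin n → ℝ}
    {g : Path n T} (hg : ∀ σ ∈ Icc 0 T, g.extend hT σ = memory N τ xt σ)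
    {z : Path n T × Path n T}
    (hz : z = (constOp xh + forward hT τ idKernel g, 0) + systemOp hT hN B Q Q₀ τ z) :
    IsExtremal T N B Q Q₀ τ xh xt (z.1.extend hT) (z.2.extend hT) := by
  rw [systemOp_apply] at hz
  have hz1 : z.1 = constOp xh + forward hT τ idKernel g + stateOp hT hN B τ z := congrArg Prod.fst hz
  have hz2 : z.2 = costateOp hT hN Q Q₀ z := by simpa using congrArg Prod.snd hz
  refine ⟨Path.continuous_extend hT _, Path.continuous_extend hT _, fun t ht => ?_, fun s hs => ?_⟩
  · have e : z.1.extend hT t = xh + (forward hT τ idKernel g).extend hT t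
        + (stateOp hT hN B τ z).extend hT t := DFunLike.congr_fun hz1 _
    have hF := continuous_forward_convolution hN (z.1.continuous_extend hT) τ
    rw [e, extend_forward_idKernel hT τ g ht, extend_stateOp hT hN B τ z ht, add_assoc, add_comm
      (∫ s in (τ : ℝ)..t, g.extend hT s), ← intervalIntegral.integral_add
      (Continuous.intervalIntegrable (by fun_prop) _ _)
      (Continuous.intervalIntegrable (by fun_prop) _ _)]
    congr 1
    refine intervalIntegral.integral_congr fun σ hσ => ?_
    rw [uIcc_of_le ht.1] at hσ
    rw [hg σ ⟨τ.2.1.trans hσ.1, hσ.2.trans ht.2⟩]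
  · have e : z.2.extend hT s = (costateOp hT hN Q Q₀ z).extend hT s := DFunLike.congr_fun hz2 _
    rw [e, extend_costateOp hT hN Q Q₀ z ⟨τ.2.1.trans hs.1, hs.2⟩]

theorem isExtremal_zero (τ : ℝ) : IsExtremal T N B Q Q₀ τ 0 0 0 0 :=
  ⟨continuous_const, continuous_const, fun t _ => by simp [memory], fun s _ => by simp⟩

/-- A fixed point is an extremal of the zero state, and so is the zero pair. Uniqueness of
minimizers gives a zero state on `[τ, T]`, and before `τ` the forward operator vanishes. The costate
then solves the homogeneous backward equation on all of `[0, T]`. -/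
theorem systemOp_fixedPoint_eq_zero (hQ : Q.PosSemidef) (hQ₀ : Q₀.PosSemidef) (τ : Icc (0 : ℝ) T)
    {z : Path n T × Path n T} (hz : z = systemOp hT hN B Q Q₀ τ z) : z = 0 := by
  have hext : IsExtremal T N B Q Q₀ τ 0 0 (z.1.extend hT) (z.2.extend hT) :=
    isExtremal_of_fixedPoint hT hN B Q Q₀ τ (g := 0) (fun σ _ => by simp [memory, Path.extend])
      (by rw [map_zero, map_zero, add_zero, Prod.mk_zero_zero, zero_add]; exact hz)
  have h0 : IsL2 0 τ (0 : ℝ → Fin n → ℝ) := MemLp.zero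
  have hx := ((isExtremal_zero B Q Q₀ (τ : ℝ)).unique τ.2 hN hQ hQ₀ h0
    (hext.isOptimalPair τ.2 hN hQ hQ₀ h0)).2
  rw [systemOp_apply] at hz
  have hz1 : z.1 = stateOp hT hN B τ z := congrArg Prod.fst hz
  have hz2 : z.2 = costateOp hT hN Q Q₀ z := congrArg Prod.snd hz
  have hx0 : z.1 = 0 := by
    ext1 t
    rcases le_total (τ : ℝ) t with h | h
    · have := hx ⟨h, t.2.2⟩
      rwa [Path.extend_of_mem hT _ t.2] at this
    · rw [hz1]
      simp [stateOp, forward, intOp_apply, max_eq_right h]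
  have hxe : ∀ s, z.1.extend hT s = 0 := fun s => by rw [hx0]; rfl
  have hp := backward_eq_zero hN (z.2.continuous_extend hT) (a := 0) (b := T) fun s hs => by
    have e : z.2.extend hT s = (costateOp hT hN Q Q₀ z).extend hT s := DFunLike.congr_fun hz2 _
    rw [e, extend_costateOp hT hN Q Q₀ z hs]
    simp [hxe]
  refine Prod.ext hx0 ?_
  ext1 t
  have := hp t t.2
  rwa [Path.extend_of_mem hT _ t.2] at this

/-- Fredholm alternative: for a compact operator, `1` is either an eigenvalue or in the resolvent
set. -/
theorem isUnit_one_sub_systemOp (hQ : Q.PosSemidef) (hQ₀ : Q₀.PosSemidef) (τ : Icc (0 : ℝ) T) :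
    IsUnit (1 - systemOp hT hN B Q Q₀ τ) := by
  rcases (isCompactOperator_systemOp hT hN B Q Q₀ τ).hasEigenvalue_or_mem_resolventSet
    (one_ne_zero (α := ℝ)) with h | h
  · obtain ⟨z, hz⟩ := h.exists_hasEigenvector
    refine absurd (systemOp_fixedPoint_eq_zero hT hN B Q Q₀ hQ hQ₀ τ (z := z) ?_) hz.2
    have := hz.apply_eq_smul
    rw [one_smul] at this
    exact this.symm
  · simpa [spectrum.mem_resolventSet_iff] using h

/-- The solution operator of the optimality system. -/
noncomputable def solutionOp (τ : Icc (0 : ℝ) T) : Path n T →L[ℝ] Path n T × Path n T :=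
  -- `Ring.inverse` is zero off the units; `isUnit_one_sub_systemOp` rules that case out when `Q`
  -- and `Q₀` are positive semidefinite.
  (Ring.inverse (1 - systemOp hT hN B Q Q₀ τ)).comp (ContinuousLinearMap.inl ℝ _ _)

theorem continuous_solutionOp (hQ : Q.PosSemidef) (hQ₀ : Q₀.PosSemidef) :
    Continuous (solutionOp hT hN B Q Q₀) := by
  have h : Continuous fun τ => Ring.inverse (1 - systemOp hT hN B Q Q₀ τ) := by
    rw [continuous_iff_continuousAt]
    intro τ
    obtain ⟨w, hw⟩ := isUnit_one_sub_systemOp hT hN B Q Q₀ hQ hQ₀ τ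
    have h1 := NormedRing.inverse_continuousAt
      (R := Path n T × Path n T →L[ℝ] Path n T × Path n T) w
    rw [hw] at h1
    exact ContinuousAt.comp (f := fun τ => 1 - systemOp hT hN B Q Q₀ τ) h1
      (continuous_const.sub (continuous_systemOp hT hN B Q Q₀)).continuousAt
  exact h.clm_comp continuous_const

theorem solutionOp_eq (hQ : Q.PosSemidef) (hQ₀ : Q₀.PosSemidef) (τ : Icc (0 : ℝ) T)
    (f : Path n T) : solutionOp hT hN B Q Q₀ τ f
      = (f, 0) + systemOp hT hN B Q Q₀ τ (solutionOp hT hN B Q Q₀ τ f) := by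
  have h := Ring.mul_inverse_cancel _ (isUnit_one_sub_systemOp hT hN B Q Q₀ hQ hQ₀ τ)
  have h' := DFunLike.congr_fun h ((f, 0) : Path n T × Path n T)
  have h'' : solutionOp hT hN B Q Q₀ τ f
      - systemOp hT hN B Q Q₀ τ (solutionOp hT hN B Q Q₀ τ f) = (f, 0) := h'
  rw [← h'']
  abel

end

/-! ### The value function as a bilinear form -/

section

variable (hT : 0 ≤ T) {N : ℝ → Matrix (Fin n) (Fin n) ℝ} (hN : Continuous N)
  (B : Matrix (Fin n) (Fin m) ℝ) (Q Q₀ : Matrix (Fin n) (Fin n) ℝ)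

/-- The path `t ↦ N (t - s) *ᵥ v`, as a linear function of `v`. -/
noncomputable def memoryKernel (s : ℝ) : (Fin n → ℝ) →L[ℝ] Path n T :=
  LinearMap.toContinuousLinearMap
    { toFun := fun v => ⟨fun t => N (t - s) *ᵥ v, by fun_prop⟩
      map_add' := fun v w => by ext1 t; simp [mulVec_add]
      map_smul' := fun c v => by ext1 t; simp [mulVec_smul] }

theorem memoryKernel_apply (s : ℝ) (v : Fin n → ℝ) (t : Icc (0 : ℝ) T) :
    memoryKernel hN s v t = N (t - s) *ᵥ v := rfl

theorem continuous_memoryKernel :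
    Continuous (memoryKernel hN : ℝ → (Fin n → ℝ) →L[ℝ] Path n T) := by
  rw [continuous_clm_apply]
  intro v
  refine ContinuousMap.continuous_of_continuous_uncurry _ ?_
  simp only [Function.uncurry_def, memoryKernel_apply]
  fun_prop

/-- The inhomogeneity produced by the history `xt`, as a path. -/
noncomputable def memoryPath (τ : ℝ) (xt : ℝ → Fin n → ℝ) : Path n T :=
  ∫ s in (0 : ℝ)..τ, memoryKernel hN s (xt s)

theorem intervalIntegrable_memoryKernel {τ : ℝ} {xt : ℝ → Fin n → ℝ}
    (hxt : IntervalIntegrable xt volume 0 τ) :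
    IntervalIntegrable (fun s => (memoryKernel hN s (xt s) : Path n T)) volume 0 τ :=
  intervalIntegrable_clm_apply (continuous_memoryKernel hN) hxt

theorem extend_memoryPath {τ : ℝ} {xt : ℝ → Fin n → ℝ} (hxt : IntervalIntegrable xt volume 0 τ)
    {σ : ℝ} (hσ : σ ∈ Icc 0 T) :
    (memoryPath hN τ xt : Path n T).extend hT σ = memory N τ xt σ := by
  rw [Path.extend_of_mem hT _ hσ]
  exact ((ContinuousMap.evalCLM ℝ (⟨σ, hσ⟩ : Icc (0 : ℝ) T)).intervalIntegral_comp_comm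
    (intervalIntegrable_memoryKernel hN hxt)).symm

/-- The inhomogeneity of the state equation for the state `(xh, xt)`. -/
noncomputable def datum (τ : Icc (0 : ℝ) T) (xh : Fin n → ℝ) (xt : ℝ → Fin n → ℝ) : Path n T :=
  constOp xh + forward hT τ idKernel (memoryPath hN τ xt)

/-- The solution operator produces the extremal of the state `(xh, xt)`. -/
theorem isExtremal_solutionOp (hQ : Q.PosSemidef) (hQ₀ : Q₀.PosSemidef) (τ : Icc (0 : ℝ) T)
    (xh : Fin n → ℝ) {xt : ℝ → Fin n → ℝ} (hxt : IsL2 0 τ xt) :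
    IsExtremal T N B Q Q₀ τ xh xt
      ((solutionOp hT hN B Q Q₀ τ (datum hT hN τ xh xt)).1.extend hT)
      ((solutionOp hT hN B Q Q₀ τ (datum hT hN τ xh xt)).2.extend hT) :=
  isExtremal_of_fixedPoint hT hN B Q Q₀ τ
    (fun _ hσ => extend_memoryPath hT hN (hxt.intervalIntegrable τ.2.1) hσ)
    (solutionOp_eq hT hN B Q Q₀ hQ hQ₀ τ _)

theorem pairing_comm {Q Q₀ : Matrix (Fin n) (Fin n) ℝ} (hQ : Q.IsHermitian)
    (hQ₀ : Q₀.IsHermitian) (τ : ℝ) (x p y q : ℝ → Fin n → ℝ) :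
    pairing T B Q Q₀ τ x p y q = pairing T B Q Q₀ τ y q x p := by
  simp only [pairing, dotProduct_mulVec_comm_of_isHermitian hQ (x _),
    dotProduct_mulVec_comm_of_isHermitian hQ₀ (x _), dotProduct_comm (Bᵀ *ᵥ p _)]

theorem pairing_add_left (τ : ℝ) {x p x' p' y q : ℝ → Fin n → ℝ} (hx : Continuous x)
    (hp : Continuous p) (hx' : Continuous x') (hp' : Continuous p') (hy : Continuous y)
    (hq : Continuous q) :
    pairing T B Q Q₀ τ (fun t => x t + x' t) (fun t => p t + p' t) y q
      = pairing T B Q Q₀ τ x p y q + pairing T B Q Q₀ τ x' p' y q := by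
  simp only [pairing]
  rw [add_add_add_comm, ← intervalIntegral.integral_add
    (Continuous.intervalIntegrable (by fun_prop) _ _)
    (Continuous.intervalIntegrable (by fun_prop) _ _), add_dotProduct]
  congr 1
  refine intervalIntegral.integral_congr fun t _ => ?_
  simp only [add_dotProduct, mulVec_add]
  ring

theorem pairing_smul_left (τ c : ℝ) (x p y q : ℝ → Fin n → ℝ) :
    pairing T B Q Q₀ τ (fun t => c • x t) (fun t => c • p t) y q
      = c * pairing T B Q Q₀ τ x p y q := by
  simp only [pairing]
  rw [mul_add, ← intervalIntegral.integral_const_mul, smul_dotProduct, smul_eq_mul]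
  congr 1
  refine intervalIntegral.integral_congr fun t _ => ?_
  simp only [smul_dotProduct, mulVec_smul, smul_eq_mul]
  ring

theorem continuous_pairing :
    Continuous fun r : Icc (0 : ℝ) T × (Path n T × Path n T) × (Path n T × Path n T) =>
      pairing T B Q Q₀ r.1 (r.2.1.1.extend hT) (r.2.1.2.extend hT) (r.2.2.1.extend hT)
        (r.2.2.2.extend hT) := by
  have hproj : Continuous (projIcc 0 T hT) := continuous_projIcc
  simp only [pairing, Path.extend]
  refine Continuous.add ?_ (by fun_prop)
  simp_rw [intervalIntegral.integral_symm T]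
  refine Continuous.neg (intervalIntegral.continuous_parametric_intervalIntegral_of_continuous
    ?_ (by fun_prop))
  simp only [Function.uncurry_def]
  fun_prop

/-- The value function as a bilinear form in the inhomogeneity. -/
noncomputable def valueForm {Q Q₀ : Matrix (Fin n) (Fin n) ℝ} (hQ : Q.PosSemidef)
    (hQ₀ : Q₀.PosSemidef) (τ : Icc (0 : ℝ) T) : Path n T →ₗ[ℝ] Path n T →ₗ[ℝ] ℝ :=
  have hadd : ∀ z w y : Path n T × Path n T,
      pairing T B Q Q₀ τ ((z + w).1.extend hT) ((z + w).2.extend hT) (y.1.extend hT)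
        (y.2.extend hT) = pairing T B Q Q₀ τ (z.1.extend hT) (z.2.extend hT) (y.1.extend hT)
        (y.2.extend hT) + pairing T B Q Q₀ τ (w.1.extend hT) (w.2.extend hT) (y.1.extend hT)
        (y.2.extend hT) := fun z w y =>
    pairing_add_left B Q Q₀ τ (z.1.continuous_extend hT) (z.2.continuous_extend hT)
      (w.1.continuous_extend hT) (w.2.continuous_extend hT) (y.1.continuous_extend hT)
      (y.2.continuous_extend hT)
  have hsmul : ∀ (c : ℝ) (z y : Path n T × Path n T),
      pairing T B Q Q₀ τ ((c • z).1.extend hT) ((c • z).2.extend hT) (y.1.extend hT)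
        (y.2.extend hT) = c * pairing T B Q Q₀ τ (z.1.extend hT) (z.2.extend hT) (y.1.extend hT)
        (y.2.extend hT) := fun c z y => pairing_smul_left B Q Q₀ τ c _ _ _ _
  (LinearMap.mk₂ ℝ (fun z w : Path n T × Path n T => pairing T B Q Q₀ τ (z.1.extend hT)
      (z.2.extend hT) (w.1.extend hT) (w.2.extend hT)) hadd hsmul
    (fun z w y => by
      simp only [pairing_comm B hQ.1 hQ₀.1 τ (z.1.extend hT)]
      exact hadd w y z)
    (fun c z w => by
      simp only [pairing_comm B hQ.1 hQ₀.1 τ (z.1.extend hT)]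
      exact hsmul c w z)).compl₁₂
    (solutionOp hT hN B Q Q₀ τ : Path n T →ₗ[ℝ] Path n T × Path n T)
    (solutionOp hT hN B Q Q₀ τ : Path n T →ₗ[ℝ] Path n T × Path n T)

variable {Q Q₀} (hQ : Q.PosSemidef) (hQ₀ : Q₀.PosSemidef)

theorem valueForm_apply (τ : Icc (0 : ℝ) T) (f g : Path n T) :
    valueForm hT hN B hQ hQ₀ τ f g = pairing T B Q Q₀ τ
      ((solutionOp hT hN B Q Q₀ τ f).1.extend hT) ((solutionOp hT hN B Q Q₀ τ f).2.extend hT)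
      ((solutionOp hT hN B Q Q₀ τ g).1.extend hT) ((solutionOp hT hN B Q Q₀ τ g).2.extend hT) :=
  rfl

theorem valueForm_comm (τ : Icc (0 : ℝ) T) (f g : Path n T) :
    valueForm hT hN B hQ hQ₀ τ f g = valueForm hT hN B hQ hQ₀ τ g f := by
  rw [valueForm_apply, valueForm_apply, pairing_comm B hQ.1 hQ₀.1]

theorem continuous_valueForm :
    Continuous fun r : Icc (0 : ℝ) T × Path n T × Path n T =>
      valueForm hT hN B hQ hQ₀ r.1 r.2.1 r.2.2 := by
  have hS := continuous_solutionOp hT hN B Q Q₀ hQ hQ₀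
  have h : Continuous fun r : Icc (0 : ℝ) T × Path n T × Path n T =>
      (r.1, solutionOp hT hN B Q Q₀ r.1 r.2.1, solutionOp hT hN B Q Q₀ r.1 r.2.2) :=
    continuous_fst.prodMk (((hS.comp continuous_fst).clm_apply (by fun_prop)).prodMk
      ((hS.comp continuous_fst).clm_apply (by fun_prop)))
  exact (continuous_pairing hT B Q Q₀).comp h

/-- The value form with its first argument fixed, as a continuous functional. -/
noncomputable def valueFunctional (τ : Icc (0 : ℝ) T) (f : Path n T) : Path n T →L[ℝ] ℝ where
  toLinearMap := valueForm hT hN B hQ hQ₀ τ f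
  cont := by
    have h : Continuous fun g : Path n T => (τ, f, g) := by fun_prop
    have h' := (continuous_valueForm hT hN B hQ hQ₀).comp h
    exact h'

theorem valueFunction_eq_valueForm (τ : Icc (0 : ℝ) T) (xh : Fin n → ℝ) {xt : ℝ → Fin n → ℝ}
    (hxt : IsL2 0 τ xt) : valueFunction T N B Q Q₀ τ xh xt
      = valueForm hT hN B hQ hQ₀ τ (datum hT hN τ xh xt) (datum hT hN τ xh xt) :=
  (isExtremal_solutionOp hT hN B Q Q₀ hQ hQ₀ τ xh hxt).valueFunction_eq τ.2 hN hQ hQ₀ hxt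

/-- `constOp η` is the datum of the state `(η, 0)`, so `IsExtremal.pairing_eq` applies. -/
theorem valueForm_constOp (τ : Icc (0 : ℝ) T) (η xh : Fin n → ℝ) {xt : ℝ → Fin n → ℝ}
    (hxt : IsL2 0 τ xt) : valueForm hT hN B hQ hQ₀ τ (constOp η) (datum hT hN τ xh xt)
      = η ⬝ᵥ (solutionOp hT hN B Q Q₀ τ (datum hT hN τ xh xt)).2.extend hT τ := by
  have h0 : datum hT hN τ η 0 = constOp η := by simp [datum, memoryPath]
  have h := isExtremal_solutionOp hT hN B Q Q₀ hQ hQ₀ τ η (xt := 0) MemLp.zero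
  rw [h0] at h
  exact (isExtremal_solutionOp hT hN B Q Q₀ hQ hQ₀ τ xh hxt).pairing_eq τ.2.2 hN h

/-- The response of the inhomogeneity to the history at time `s`. -/
noncomputable def historyOp (τ : Icc (0 : ℝ) T) (s : ℝ) : (Fin n → ℝ) →L[ℝ] Path n T :=
  (forward hT τ idKernel).comp (memoryKernel hN s)

theorem continuous_historyOp :
    Continuous fun r : Icc (0 : ℝ) T × ℝ => historyOp hT hN r.1 r.2 :=
  ((continuous_forward hT idKernel).comp continuous_fst).clm_comp
    ((continuous_memoryKernel hN).comp continuous_snd)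

theorem forward_memoryPath (τ : Icc (0 : ℝ) T) {xt : ℝ → Fin n → ℝ}
    (hxt : IntervalIntegrable xt volume 0 τ) : forward hT τ idKernel (memoryPath hN τ xt)
      = ∫ s in (0 : ℝ)..τ, historyOp hT hN τ s (xt s) :=
  ((forward hT τ idKernel).intervalIntegral_comp_comm
    (intervalIntegrable_memoryKernel hN hxt)).symm

theorem intervalIntegrable_historyOp (τ : Icc (0 : ℝ) T) {xt : ℝ → Fin n → ℝ}
    (hxt : IntervalIntegrable xt volume 0 τ) :
    IntervalIntegrable (fun s => historyOp hT hN τ s (xt s)) volume 0 τ :=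
  intervalIntegrable_clm_apply ((continuous_historyOp hT hN).comp (Continuous.prodMk_right τ)) hxt

/-- The matrix of the value form composed with two linear maps. -/
noncomputable def formMatrix (τ : Icc (0 : ℝ) T) (L M : (Fin n → ℝ) →L[ℝ] Path n T) :
    Matrix (Fin n) (Fin n) ℝ :=
  Matrix.of fun i j => valueForm hT hN B hQ hQ₀ τ (L (Pi.single i 1)) (M (Pi.single j 1))

theorem dotProduct_formMatrix_mulVec (τ : Icc (0 : ℝ) T) (L M : (Fin n → ℝ) →L[ℝ] Path n T)
    (v w : Fin n → ℝ) : v ⬝ᵥ formMatrix hT hN B hQ hQ₀ τ L M *ᵥ w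
      = valueForm hT hN B hQ hQ₀ τ (L v) (M w) := by
  set β := (valueForm hT hN B hQ hQ₀ τ).compl₁₂ (L : (Fin n → ℝ) →ₗ[ℝ] Path n T)
    (M : (Fin n → ℝ) →ₗ[ℝ] Path n T) with hβ
  have e : formMatrix hT hN B hQ hQ₀ τ L M = LinearMap.toMatrix₂' ℝ β := by
    ext i j
    rw [LinearMap.toMatrix₂'_apply]
    rfl
  rw [e, ← Matrix.toLinearMap₂'_apply' (T := ℝ), Matrix.toLinearMap₂'_toMatrix']
  rfl

theorem transpose_formMatrix (τ : Icc (0 : ℝ) T) (L M : (Fin n → ℝ) →L[ℝ] Path n T) :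
    (formMatrix hT hN B hQ hQ₀ τ L M)ᵀ = formMatrix hT hN B hQ hQ₀ τ M L := by
  ext i j
  exact valueForm_comm hT hN B hQ hQ₀ τ _ _

theorem continuous_formMatrix {X : Type*} [TopologicalSpace X] {τ : X → Icc (0 : ℝ) T}
    {L M : X → (Fin n → ℝ) →L[ℝ] Path n T} (hτ : Continuous τ) (hL : Continuous L)
    (hM : Continuous M) : Continuous fun r => formMatrix hT hN B hQ hQ₀ (τ r) (L r) (M r) := by
  refine continuous_matrix fun i j => ?_
  have h : Continuous fun r => (τ r, L r (Pi.single i 1), M r (Pi.single j 1)) :=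
    hτ.prodMk ((hL.clm_apply continuous_const).prodMk (hM.clm_apply continuous_const))
  have h' := (continuous_valueForm hT hN B hQ hQ₀).comp h
  exact h'

end

/-! ### Kernels of the value function and the costate -/

/-- The datum is `constOp xh` plus the integral of `historyOp` along the history. Expanding the form
on this sum, the kernels are the matrices of its constant–constant, constant–history and
history–history blocks. -/
theorem exists_isValueKernel (hT : 0 ≤ T) {N : ℝ → Matrix (Fin n) (Fin n) ℝ} (hN : Continuous N)
    (B : Matrix (Fin n) (Fin m) ℝ) {Q Q₀ : Matrix (Fin n) (Fin n) ℝ} (hQ : Q.PosSemidef)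
    (hQ₀ : Q₀.PosSemidef) : ∃ P₀ P₁ K, IsValueKernel T N B Q Q₀ P₀ P₁ K := by
  have hproj : Continuous (projIcc 0 T hT) := continuous_projIcc
  have hH := continuous_historyOp hT hN
  refine ⟨fun t => formMatrix hT hN B hQ hQ₀ (projIcc 0 T hT t) constOp constOp,
    fun t s => formMatrix hT hN B hQ hQ₀ (projIcc 0 T hT t) constOp
      (historyOp hT hN (projIcc 0 T hT t) s),
    -- `r` comes before `ξ`: in the value formula `xt r` stands on the left of `K τ ξ r` and `xt ξ`
    -- on the right.
    fun t ξ r => formMatrix hT hN B hQ hQ₀ (projIcc 0 T hT t)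
      (historyOp hT hN (projIcc 0 T hT t) r) (historyOp hT hN (projIcc 0 T hT t) ξ), ?_⟩
  constructor
  · exact (continuous_formMatrix hT hN B hQ hQ₀ hproj continuous_const
      continuous_const).continuousOn
  · exact (continuous_formMatrix hT hN B hQ hQ₀ (hproj.comp continuous_fst) continuous_const
      (hH.comp ((hproj.comp continuous_fst).prodMk continuous_snd))).continuousOn
  · exact (continuous_formMatrix hT hN B hQ hQ₀ (hproj.comp continuous_fst)
      (hH.comp ((hproj.comp continuous_fst).prodMk continuous_snd.snd))
      (hH.comp ((hproj.comp continuous_fst).prodMk continuous_snd.fst))).continuousOn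
  · exact fun t _ => transpose_formMatrix hT hN B hQ hQ₀ _ _ _
  · exact fun t _ ξ _ r _ => (transpose_formMatrix hT hN B hQ hQ₀ _ _ _).symm
  · intro τ hτ xh xt hxt
    have hi := hxt.intervalIntegrable hτ.1
    set τ' : Icc (0 : ℝ) T := ⟨τ, hτ⟩ with hτ'
    have hHi := intervalIntegrable_historyOp hT hN τ' hi
    set f := forward hT τ' idKernel (memoryPath hN τ xt) with hf
    have hint : ∀ g, ∫ s in (0 : ℝ)..τ, valueForm hT hN B hQ hQ₀ τ' g (historyOp hT hN τ' s (xt s))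
        = valueForm hT hN B hQ hQ₀ τ' g f := fun g => by
      rw [hf, show memoryPath hN τ xt = memoryPath hN (τ' : ℝ) xt from rfl,
        forward_memoryPath hT hN τ' hi]
      -- Continuity in the second argument lets the form pass under the path-valued integral.
      exact (valueFunctional hT hN B hQ hQ₀ τ' g).intervalIntegral_comp_comm hHi
    have hP₁i : IntervalIntegrable (fun s => formMatrix hT hN B hQ hQ₀ τ' constOp
        (historyOp hT hN τ' s) *ᵥ xt s) volume 0 τ :=
      intervalIntegrable_clm_apply (L := fun s => mulVecCLM (formMatrix hT hN B hQ hQ₀ τ' constOp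
        (historyOp hT hN τ' s))) (continuous_mulVecCLM.comp
        (continuous_formMatrix hT hN B hQ hQ₀ continuous_const continuous_const
          (hH.comp (Continuous.prodMk_right τ')))) hi
    have e1 : xh ⬝ᵥ ∫ s in (0 : ℝ)..τ, formMatrix hT hN B hQ hQ₀ τ' constOp
        (historyOp hT hN τ' s) *ᵥ xt s = valueForm hT hN B hQ hQ₀ τ' (constOp xh) f := by
      rw [dotProduct_intervalIntegral _ hP₁i]
      simp only [dotProduct_formMatrix_mulVec]
      exact hint _
    have e2 : ∫ r in (0 : ℝ)..τ, ∫ ξ in (0 : ℝ)..τ, xt r ⬝ᵥ formMatrix hT hN B hQ hQ₀ τ'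
        (historyOp hT hN τ' r) (historyOp hT hN τ' ξ) *ᵥ xt ξ
        = valueForm hT hN B hQ hQ₀ τ' f f := by
      simp only [dotProduct_formMatrix_mulVec, hint]
      simp only [valueForm_comm hT hN B hQ hQ₀ τ' _ f, hint]
    simp only [projIcc_of_mem hT hτ]
    rw [dotProduct_comm (∫ s in (0 : ℝ)..τ, _) xh, e1, e2, dotProduct_formMatrix_mulVec]
    have e3 : datum hT hN τ' xh xt = constOp xh + f := rfl
    have e4 := valueFunction_eq_valueForm hT hN B hQ hQ₀ τ' xh hxt
    rw [e3] at e4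
    simp only [map_add, LinearMap.add_apply] at e4
    rw [valueForm_comm hT hN B hQ hQ₀ τ' f (constOp xh)] at e4
    linarith

/-- The costate at time `τ` is expressed by the kernels of the value function. -/
theorem IsExtremal.costate_eq_kernel (hT : 0 ≤ T) {N : ℝ → Matrix (Fin n) (Fin n) ℝ}
    (hN : Continuous N) {B : Matrix (Fin n) (Fin m) ℝ} {Q Q₀ : Matrix (Fin n) (Fin n) ℝ}
    (hQ : Q.PosSemidef) (hQ₀ : Q₀.PosSemidef) {P₀ : ℝ → Matrix (Fin n) (Fin n) ℝ}
    {P₁ : ℝ → ℝ → Matrix (Fin n) (Fin n) ℝ} {K : ℝ → ℝ → ℝ → Matrix (Fin n) (Fin n) ℝ}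
    (hK : IsValueKernel T N B Q Q₀ P₀ P₁ K) {τ : ℝ} (hτ : τ ∈ Icc 0 T) {xh : Fin n → ℝ}
    {xt x p : ℝ → Fin n → ℝ} (hxt : IsL2 0 τ xt) (h : IsExtremal T N B Q Q₀ τ xh xt x p) :
    p τ = P₀ τ *ᵥ xh + ∫ s in (0 : ℝ)..τ, P₁ τ s *ᵥ xt s := by
  set τ' : Icc (0 : ℝ) T := ⟨τ, hτ⟩
  set f := datum hT hN τ' xh xt with hf
  have hp : (solutionOp hT hN B Q Q₀ τ' f).2.extend hT τ = p τ :=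
    h.costate_unique hτ hN hQ hQ₀ hxt (isExtremal_solutionOp hT hN B Q Q₀ hQ hQ₀ τ' xh hxt)
      ⟨le_rfl, hτ.2⟩
  refine dotProduct_eq _ _ fun η => ?_
  rw [dotProduct_comm _ η, dotProduct_comm _ η]
  -- Polarization: the value at `xh + η` minus that at `xh - η` is `4 η ⬝ᵥ p τ` by the form and `4 η
  -- ⬝ᵥ (P₀ τ *ᵥ xh + ∫ P₁ τ s *ᵥ xt s)` by the kernels; the `K` terms cancel.
  have h1 := valueFunction_eq_valueForm hT hN B hQ hQ₀ τ' (xh + η) hxt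
  have h2 := valueFunction_eq_valueForm hT hN B hQ hQ₀ τ' (xh - η) hxt
  have d1 : datum hT hN τ' (xh + η) xt = f + constOp η := by
    simp only [hf, datum, map_add]
    abel
  have d2 : datum hT hN τ' (xh - η) xt = f - constOp η := by
    simp only [hf, datum, map_sub]
    abel
  have e := valueForm_constOp hT hN B hQ hQ₀ τ' η xh hxt
  have hc := valueForm_comm hT hN B hQ hQ₀ τ' f (constOp η)
  have hs := dotProduct_mulVec_comm_of_isHermitian (Q := P₀ τ)
    (by rw [IsHermitian, conjTranspose_eq_transpose_of_trivial, hK.symm_P₀ τ hτ]) xh η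
  rw [hK.value_eq τ hτ _ _ hxt, d1] at h1
  rw [hK.value_eq τ hτ _ _ hxt, d2] at h2
  change _ = η ⬝ᵥ (solutionOp hT hN B Q Q₀ τ' f).2.extend hT τ at e
  rw [hp] at e
  simp only [map_add, map_sub, LinearMap.add_apply, LinearMap.sub_apply, mulVec_add, mulVec_sub,
    dotProduct_add, dotProduct_sub, add_dotProduct, sub_dotProduct,
    dotProduct_comm (∫ s in (0 : ℝ)..τ, _) _] at h1 h2 ⊢
  rw [← hf] at e
  linarith

/-! ### Changing `N` outside `[0, T]` -/

section

variable {N N' : ℝ → Matrix (Fin n) (Fin n) ℝ} {B : Matrix (Fin n) (Fin m) ℝ}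
  {Q Q₀ : Matrix (Fin n) (Fin n) ℝ}

theorem isAdmissiblePair_congr (hNN' : EqOn N N' (Icc 0 T)) {τ : ℝ} (hτ : τ ∈ Icc 0 T) :
    IsAdmissiblePair T N B τ = IsAdmissiblePair T N' B τ := by
  ext xh xt u x
  exact and_congr_right fun _ =>
    ⟨fun h => h.congr hτ hNN' fun _ _ => rfl, fun h => h.congr hτ hNN'.symm fun _ _ => rfl⟩

theorem isValueKernel_congr (hNN' : EqOn N N' (Icc 0 T)) {P₀ : ℝ → Matrix (Fin n) (Fin n) ℝ}
    {P₁ : ℝ → ℝ → Matrix (Fin n) (Fin n) ℝ} {K : ℝ → ℝ → ℝ → Matrix (Fin n) (Fin n) ℝ}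
    (h : IsValueKernel T N B Q Q₀ P₀ P₁ K) : IsValueKernel T N' B Q Q₀ P₀ P₁ K where
  __ := h
  value_eq τ hτ xh xt hxt := by
    rw [← h.value_eq τ hτ xh xt hxt, valueFunction, valueFunction,
      isAdmissiblePair_congr hNN' hτ]

theorem isOptimalPair_congr (hNN' : EqOn N N' (Icc 0 T)) {τ : ℝ} (hτ : τ ∈ Icc 0 T) :
    IsOptimalPair T N B Q Q₀ τ = IsOptimalPair T N' B Q Q₀ τ := by
  ext xh xt u x
  rw [IsOptimalPair, IsOptimalPair, isAdmissiblePair_congr hNN' hτ]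

end

end

end VolterraLQ

/-! ### Existence of kernels and the feedback law -/

theorem mainTheorem2 {n m : ℕ} (T : ℝ) (hT : 0 < T)
    (N : ℝ → Matrix (Fin n) (Fin n) ℝ) (hN : ContinuousOn N (Icc 0 T))
    (B : Matrix (Fin n) (Fin m) ℝ) (Q Q₀ : Matrix (Fin n) (Fin n) ℝ)
    (hQ : Q.PosSemidef) (hQ₀ : Q₀.PosSemidef) :
    (∃ P₀ P₁ K, VolterraLQ.IsValueKernel T N B Q Q₀ P₀ P₁ K) ∧
    ∀ P₀ P₁ K, VolterraLQ.IsValueKernel T N B Q Q₀ P₀ P₁ K →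
      ∀ τ ∈ Ico 0 T, ∀ (xh : Fin n → ℝ) (xt : ℝ → Fin n → ℝ), VolterraLQ.IsL2 0 τ xt →
        ∃ (u : ℝ → Fin m → ℝ) (x : ℝ → Fin n → ℝ),
          VolterraLQ.IsOptimalPair T N B Q Q₀ τ xh xt u x ∧
          (∀ v y, VolterraLQ.IsOptimalPair T N B Q Q₀ τ xh xt v y →
            v =ᵐ[volume.restrict (Ioc τ T)] u ∧ EqOn y x (Icc τ T)) ∧
          ContinuousOn u (Icc τ T) ∧
          u τ = -(Bᵀ *ᵥ (P₀ τ *ᵥ xh + ∫ s in (0 : ℝ)..τ, P₁ τ s *ᵥ xt s)) ∧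
          ∀ t ∈ Icc τ T, u t = -(Bᵀ *ᵥ (P₀ t *ᵥ x t +
            ∫ s in (0 : ℝ)..t, P₁ t s *ᵥ VolterraLQ.extendBy τ xt x s)) := by
  -- Only lags in `[0, T]` occur, so `N` may be replaced by its constant continuous extension.
  obtain ⟨N', hN', hEq⟩ : ∃ N' : ℝ → Matrix (Fin n) (Fin n) ℝ, Continuous N' ∧
      EqOn N N' (Icc 0 T) :=
    ⟨_, (continuousOn_iff_continuous_domRestrict.1 hN).Icc_extend' (h := hT.le), fun t ht => by
      rw [IccExtend_of_mem _ _ ht, domRestrict_apply]⟩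
  refine ⟨?_, ?_⟩
  · obtain ⟨P₀, P₁, K, h⟩ := VolterraLQ.exists_isValueKernel hT.le hN' B hQ hQ₀
    exact ⟨P₀, P₁, K, VolterraLQ.isValueKernel_congr hEq.symm h⟩
  · intro P₀ P₁ K hK τ hτ xh xt hxt
    have hτ' : τ ∈ Icc 0 T := Ico_subset_Icc_self hτ
    have hK' := VolterraLQ.isValueKernel_congr hEq hK
    have h := VolterraLQ.isExtremal_solutionOp hT.le hN' B Q Q₀ hQ hQ₀ ⟨τ, hτ'⟩ xh hxt
    have hp := h.continuous_costate
    rw [VolterraLQ.isOptimalPair_congr hEq hτ']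
    refine ⟨_, _, h.isOptimalPair hτ' hN' hQ hQ₀ hxt, fun v y hvy =>
      h.unique hτ' hN' hQ hQ₀ hxt hvy, Continuous.continuousOn (by fun_prop), ?_, fun t ht => ?_⟩
    · rw [← h.costate_eq_kernel hT.le hN' hQ hQ₀ hK' hτ' hxt]
    -- Dynamic programming: the costate formula is applied at time `t` to the restarted extremal,
    -- whose costate is still `p`.
    · rw [← (h.restrict hτ.1 hN' hxt ht).costate_eq_kernel hT.le hN' hQ hQ₀ hK'
        ⟨hτ.1.trans ht.1, ht.2⟩ (VolterraLQ.isL2_extendBy hxt h.continuous_state)]
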